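/- Consider the quantum walk on the lattice $\mathbb{H}=\mathbb{H}_1\cup\mathbb{H}_2\subset\mathbb{R}^2$, where $\mathbb{H}_1=\{(\frac{3x}{2},\frac{\sqrt3 y}{2}) : x,y\in\mathbb{Z}\}$ and $\mathbb{H}_2=\{(\frac{3x+1}{2},\frac{\sqrt3 y}{2}) : x,y\in\mathbb{Z}\}$, with state space $\ell^2(\mathbb{H})\otimes\mathbb{C}^3$. Let $\theta\in[0,2\pi)$ with $\theta\neq 0,\pi$, and put $c=\cos\theta$, $s=\sin\theta$. The coin-flip operator $C$ acts on the coin state at every vertex by the matrix $$\begin{bmatrix} -\frac{1+c}{2} & \frac{s}{\sqrt2} & \frac{1-c}{2}\\ \frac{s}{\sqrt2} & c & \frac{s}{\sqrt2}\\ \frac{1-c}{2} & \frac{s}{\sqrt2} & -\frac{1+c}{2}\end{bmatrix}.$$ The shift $S_1$ moves the coin states $|0\rangle,|1\rangle,|2\rangle$ at a vertex $(\frac{3x}{2},\frac{\sqrt3y}{2})$ of $\mathbb{H}_1$ to $(\frac{3x+1}{2},\frac{\sqrt3(y+1)}{2})$, $(\frac{3x-2}{2},\frac{\sqrt3y}{2})$,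 $(\frac{3x+1}{2},\frac{\sqrt3(y-1)}{2})$ respectively, without changing the coin state, and annihilates the states at the vertices of $\mathbb{H}_2$. The shift $S_2$ moves the coin states $|0\rangle,|1\rangle,|2\rangle$ at a vertex $(\frac{3x+1}{2},\frac{\sqrt3y}{2})$ of $\mathbb{H}_2$ to $(\frac{3x}{2},\frac{\sqrt3(y-1)}{2})$, $(\frac{3x+3}{2},\frac{\sqrt3y}{2})$, $(\frac{3x}{2},\frac{\sqrt3(y+1)}{2})$ respectively, and annihilates the states at the vertices of $\mathbb{H}_1$. The walk starts from $|\Psi_0\rangle=|0,0\rangle\otimes(\alpha|0\rangle+\beta|1\rangle+\gamma|2\rangle)$ with $\alpha,\beta,\gamma\in\mathbb{C}$ and $|\alpha|^2+|\beta|^2+|\gamma|^2=1$, and evolves by $|\Psi_{t+1}\rangle=(S_1+S_2)C|\Psi_t\rangle$. Let $\mathbb{P}[(X_t,Y_t)=(\chi,\upsilon)]$ be the squared norm of the $\mathbb{C}^3$-component of $|\Psi_t\rangle$ at $(\chi,\upsilon)$. Then $\mathbb{P}[(X_{2t+1},Y_{2t+1})=(0,0)]=0$ for every integer $t\ge0$,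 and $$\begin{aligned}\lim_{t\to\infty}\mathbb{P}[(X_{2t},Y_{2t})=(0,0)]={}&\left|\left(\tfrac12-\tfrac{A(\theta)}{\pi}\right)\alpha-\tfrac{\sqrt2\,s\,A(\theta)}{\pi(1-c)}\beta+\left\{\tfrac{(3+c)A(\theta)}{\pi(1-c)}-\tfrac12\right\}\gamma\right|^2\\&+\left|\tfrac{\sqrt2\,A(\theta)}{\pi(1-c)}\left\{s\alpha-\sqrt2(1-c)\beta+s\gamma\right\}\right|^2\\&+\left|\left\{\tfrac{(3+c)A(\theta)}{\pi(1-c)}-\tfrac12\right\}\alpha-\tfrac{\sqrt2\,s\,A(\theta)}{\pi(1-c)}\beta+\left(\tfrac12-\tfrac{A(\theta)}{\pi}\right)\gamma\right|^2,\end{aligned}$$ where $A(\theta)=\arcsin\left(\frac{1-\cos\theta}{3+\cos\theta}\right)$. -/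

import Mathlib

open Filter Topology
open scoped ENNReal

namespace HexWalk

/-- Vertices of the lattice `ℍ = ℍ₁ ∪ ℍ₂`, in integer coordinates:
`one x y` is the point `(3x/2, √3y/2)` of `ℍ₁` and `two x y` is the point
`((3x+1)/2, √3y/2)` of `ℍ₂`. -/
inductive Site where
  | one (x y : ℤ) : Site
  | two (x y : ℤ) : Site
  deriving DecidableEq

/-- The position of a vertex in the plane. -/
noncomputable def Site.pos : Site → ℝ × ℝ
  | .one x y => (3 * (x : ℝ) / 2, √3 * (y : ℝ) / 2)
  | .two x y => ((3 * (x : ℝ) + 1) / 2, √3 * (y : ℝ) / 2)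

/-- Distinct vertices occupy distinct points of the plane. -/
theorem Site.pos_injective : Function.Injective Site.pos := by
  have h3 : (√3 : ℝ) ≠ 0 := by positivity
  have key : ∀ y y' : ℤ, √3 * (y : ℝ) / 2 = √3 * (y' : ℝ) / 2 → y = y' := by
    intro y y' h
    have h' : √3 * (y : ℝ) = √3 * (y' : ℝ) := by linarith
    exact_mod_cast mul_left_cancel₀ h3 h'
  rintro (⟨x, y⟩ | ⟨x, y⟩) (⟨x', y'⟩ | ⟨x', y'⟩) h <;>
    simp only [Site.pos, Prod.mk.injEq] at h <;> obtain ⟨h1, h2⟩ := h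
  · have hx : (x : ℝ) = x' := by linarith
    rw [key _ _ h2, Int.cast_injective hx]
  · have hx : (3 * (x : ℝ)) = 3 * x' + 1 := by linarith
    have hx' : 3 * x = 3 * x' + 1 := by exact_mod_cast hx
    omega
  · have hx : (3 * (x : ℝ)) + 1 = 3 * x' := by linarith
    have hx' : 3 * x + 1 = 3 * x' := by exact_mod_cast hx
    omega
  · have hx : (x : ℝ) = x' := by linarith
    rw [key _ _ h2, Int.cast_injective hx]

/-- The Hilbert space of the walk: square-summable amplitudes indexed by a position and a
coin state, that is, the Hilbert tensor product of `ℓ²(ℍ)` and `ℂ³`. -/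
abbrev State : Type := lp (fun _ : Site × Fin 3 => ℂ) 2

/-- The basis vector `|v⟩ ⊗ |j⟩`. -/
noncomputable def ket (v : Site) (j : Fin 3) : State :=
  lp.single 2 (v, j) (1 : ℂ)

/-- The `3 × 3` coin matrix with parameter `θ`. -/
noncomputable def coinMatrix (θ : ℝ) : Matrix (Fin 3) (Fin 3) ℝ :=
  !![-(1 + Real.cos θ) / 2, Real.sin θ / √2, (1 - Real.cos θ) / 2;
     Real.sin θ / √2, Real.cos θ, Real.sin θ / √2;
     (1 - Real.cos θ) / 2, Real.sin θ / √2, -(1 + Real.cos θ) / 2]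

theorem memℓp_comp {f : Site × Fin 3 → ℂ} (hf : Memℓp f 2)
    {g : Site × Fin 3 → Site × Fin 3} (hg : Function.Injective g) : Memℓp (f ∘ g) 2 := by
  have h2 : 0 < (2 : ℝ≥0∞).toReal := by norm_num
  rw [memℓp_gen_iff h2] at hf ⊢
  exact hf.comp_injective hg

theorem memℓp_of_le {f g : Site × Fin 3 → ℂ} (hf : Memℓp f 2)
    (h : ∀ i, ‖g i‖ ≤ ‖f i‖) : Memℓp g 2 := by
  have h2 : 0 < (2 : ℝ≥0∞).toReal := by norm_num
  rw [memℓp_gen_iff h2] at hf ⊢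
  exact hf.of_nonneg_of_le (fun i => by positivity)
    (fun i => Real.rpow_le_rpow (norm_nonneg _) (h i) h2.le)

/-- The neighbour of a vertex along the edge labelled `j`. The move from `one` to `two` is the
one of `S₁`, and the move from `two` to `one`, along the same edge, is the one of `S₂`. -/
def Site.move : Site → Fin 3 → Site
  | .one x y, 0 => .two x (y + 1)
  | .one x y, 1 => .two (x - 1) y
  | .one x y, 2 => .two x (y - 1)
  | .two x y, 0 => .one x (y - 1)
  | .two x y, 1 => .one (x + 1) y
  | .two x y, 2 => .one x (y + 1)

theorem Site.move_move (v : Site) (j : Fin 3) : (v.move j).move j = v := by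
  fin_cases j <;> cases v <;> simp [Site.move]

/-- Whether a vertex belongs to `ℍ₁`. -/
def Site.inOne : Site → Prop
  | .one _ _ => True
  | .two _ _ => False

/-- Whether a vertex belongs to `ℍ₂`. -/
def Site.inTwo : Site → Prop
  | .one _ _ => False
  | .two _ _ => True

instance : DecidablePred Site.inOne := fun v => by cases v <;> unfold Site.inOne <;> infer_instance
instance : DecidablePred Site.inTwo := fun v => by cases v <;> unfold Site.inTwo <;> infer_instance

theorem move_injective :
    Function.Injective (fun i : Site × Fin 3 => (i.1.move i.2, i.2)) := by
  rintro ⟨v, j⟩ ⟨w, k⟩ h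
  simp only [Prod.mk.injEq] at h
  obtain ⟨h1, rfl⟩ := h
  rw [← v.move_move j, h1, w.move_move]

/-- The position shift `S₁ = ∑ |v.move j⟩⟨v| ⊗ |j⟩⟨j|` over `v ∈ ℍ₁` and `j`. Its amplitude at
`(w, j)` is the amplitude of its argument at `(v, j)` for the only `v` with `v.move j = w`
(namely `v = w.move j`) if `w ∈ ℍ₂`, and it is zero if `w ∈ ℍ₁`. -/
noncomputable def S₁ : State →ₗ[ℂ] State where
  toFun Ψ := ⟨fun i => if i.1.inTwo then Ψ (i.1.move i.2, i.2) else 0,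
    memℓp_of_le (memℓp_comp (lp.memℓp Ψ) move_injective) (fun i => by
      by_cases h : i.1.inTwo <;> simp [h])⟩
  map_add' Ψ Φ := by
    refine Subtype.ext (funext fun i => ?_)
    change (if i.1.inTwo then Ψ (i.1.move i.2, i.2) + Φ (i.1.move i.2, i.2) else 0)
      = (if i.1.inTwo then Ψ (i.1.move i.2, i.2) else 0)
        + (if i.1.inTwo then Φ (i.1.move i.2, i.2) else 0)
    by_cases h : i.1.inTwo <;> simp [h]
  map_smul' a Ψ := by
    ext i; by_cases h : i.1.inTwo <;> simp [h]

/-- The position shift `S₂ = ∑ |v.move j⟩⟨v| ⊗ |j⟩⟨j|` over `v ∈ ℍ₂` and `j`. -/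
noncomputable def S₂ : State →ₗ[ℂ] State where
  toFun Ψ := ⟨fun i => if i.1.inOne then Ψ (i.1.move i.2, i.2) else 0,
    memℓp_of_le (memℓp_comp (lp.memℓp Ψ) move_injective) (fun i => by
      by_cases h : i.1.inOne <;> simp [h])⟩
  map_add' Ψ Φ := by
    refine Subtype.ext (funext fun i => ?_)
    change (if i.1.inOne then Ψ (i.1.move i.2, i.2) + Φ (i.1.move i.2, i.2) else 0)
      = (if i.1.inOne then Ψ (i.1.move i.2, i.2) else 0)
        + (if i.1.inOne then Φ (i.1.move i.2, i.2) else 0)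
    by_cases h : i.1.inOne <;> simp [h]
  map_smul' a Ψ := by
    ext i; by_cases h : i.1.inOne <;> simp [h]

theorem S₁_ket_one (x y : ℤ) (j : Fin 3) :
    S₁ (ket (.one x y) j) = ket ((Site.one x y).move j) j := by
  ext ⟨w, k⟩
  fin_cases j <;> fin_cases k <;> cases w <;>
    simp [S₁, ket, lp.single_apply, Pi.single_apply, Site.move, Site.inTwo, eq_sub_iff_add_eq,
      sub_eq_iff_eq_add]

theorem S₁_ket_two (x y : ℤ) (j : Fin 3) : S₁ (ket (.two x y) j) = 0 := by
  ext ⟨w, k⟩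
  fin_cases j <;> fin_cases k <;> cases w <;>
    simp [S₁, ket, lp.single_apply, Pi.single_apply, Site.move, Site.inTwo]

theorem S₂_ket_two (x y : ℤ) (j : Fin 3) :
    S₂ (ket (.two x y) j) = ket ((Site.two x y).move j) j := by
  ext ⟨w, k⟩
  fin_cases j <;> fin_cases k <;> cases w <;>
    simp [S₂, ket, lp.single_apply, Pi.single_apply, Site.move, Site.inOne, eq_sub_iff_add_eq,
      sub_eq_iff_eq_add]

theorem S₂_ket_one (x y : ℤ) (j : Fin 3) : S₂ (ket (.one x y) j) = 0 := by
  ext ⟨w, k⟩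
  fin_cases j <;> fin_cases k <;> cases w <;>
    simp [S₂, ket, lp.single_apply, Pi.single_apply, Site.move, Site.inOne]

theorem memℓp_coin (θ : ℝ) (Ψ : State) :
    Memℓp (fun i : Site × Fin 3 => ∑ k, (coinMatrix θ i.2 k : ℂ) * Ψ (i.1, k)) 2 := by
  have h2 : 0 < (2 : ℝ≥0∞).toReal := by norm_num
  have hk : ∀ k : Fin 3, Summable fun i : Site × Fin 3 => ‖Ψ (i.1, k)‖ ^ (2 : ℝ≥0∞).toReal := by
    intro k
    have hs := (memℓp_gen_iff h2).1 (lp.memℓp Ψ)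
    have hv : Summable fun v : Site => ‖Ψ (v, k)‖ ^ (2 : ℝ≥0∞).toReal :=
      hs.comp_injective (i := fun v : Site => (v, k)) (fun v w h => by simpa using h)
    refine (Equiv.prodComm (Fin 3) Site).summable_iff.1 ?_
    refine (summable_prod_of_nonneg (fun i => Real.rpow_nonneg (norm_nonneg _) _)).2 ⟨fun j => ?_, ?_⟩
    · simpa using hv
    · exact Summable.of_finite
  have hm : ∀ k : Fin 3,
      Memℓp (fun i : Site × Fin 3 => (coinMatrix θ i.2 k : ℂ) * Ψ (i.1, k)) 2 := by
    intro k
    refine memℓp_of_le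
      (f := (((∑ j, |coinMatrix θ j k| : ℝ) : ℂ)) • fun i : Site × Fin 3 => Ψ (i.1, k)) ?_ ?_
    · exact ((memℓp_gen_iff h2).2 (hk k)).const_smul _
    · intro i
      simp only [Pi.smul_apply, smul_eq_mul, norm_mul, Complex.norm_real, Real.norm_eq_abs]
      refine mul_le_mul_of_nonneg_right ?_ (norm_nonneg _)
      refine le_trans ?_ (le_abs_self _)
      exact Finset.single_le_sum (f := fun j => |coinMatrix θ j k|)
        (fun j _ => abs_nonneg _) (Finset.mem_univ i.2)
  have := Memℓp.finsetSum Finset.univ (fun k _ => hm k)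
  simpa using this

/-- The coin-flip operator: the coin matrix acts on the coin state at every vertex. -/
noncomputable def coin (θ : ℝ) : State →ₗ[ℂ] State where
  toFun Ψ := ⟨fun i => ∑ k, (coinMatrix θ i.2 k : ℂ) * Ψ (i.1, k), memℓp_coin θ Ψ⟩
  map_add' Ψ Φ := by
    refine Subtype.ext (funext fun i => ?_)
    change (∑ k, (coinMatrix θ i.2 k : ℂ) * (Ψ (i.1, k) + Φ (i.1, k)))
      = (∑ k, (coinMatrix θ i.2 k : ℂ) * Ψ (i.1, k)) + ∑ k, (coinMatrix θ i.2 k : ℂ) * Φ (i.1, k)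
    simp [mul_add, Finset.sum_add_distrib]
  map_smul' a Ψ := by
    ext i; simp [Finset.mul_sum, mul_left_comm]

/-- The origin of the lattice. -/
def origin : Site := .one 0 0

theorem pos_origin : origin.pos = (0, 0) := by simp [origin, Site.pos]

/-- The initial state `|0,0⟩ ⊗ (α|0⟩ + β|1⟩ + γ|2⟩)`. -/
noncomputable def initial (α β γ : ℂ) : State :=
  α • ket origin 0 + β • ket origin 1 + γ • ket origin 2

/-- The state at time `t`: `Ψ₀` is the initial state and `Ψ_{t+1} = (S₁ + S₂) C Ψ_t`. -/
noncomputable def walk (θ : ℝ) (α β γ : ℂ) : ℕ → State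
  | 0 => initial α β γ
  | t + 1 => (S₁ + S₂) (coin θ (walk θ α β γ t))

/-- The probability of observing the walker at the point `q` of the plane at time `t`, that is
`⟨Ψ_t| (|q⟩⟨q| ⊗ ∑ⱼ |j⟩⟨j|) |Ψ_t⟩`; the outer sum has at most one term. -/
noncomputable def prob (θ : ℝ) (α β γ : ℂ) (t : ℕ) (q : ℝ × ℝ) : ℝ :=
  ∑' v : {v : Site // v.pos = q}, ∑ j : Fin 3, ‖walk θ α β γ t (v.1, j)‖ ^ 2

/-- `A(θ) = arcsin ((1 - cos θ) / (3 + cos θ))`. -/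
noncomputable def A (θ : ℝ) : ℝ :=
  Real.arcsin ((1 - Real.cos θ) / (3 + Real.cos θ))

end HexWalk

/-! In Fourier space two steps of the walk multiply the coin vector by the matrix `evol θ b a`, and
the amplitudes at the origin at even times are averages over the torus of entries of its powers
(`walk_even_origin`). The walk alternates between the two sublattices, which settles the odd times.

The coin is a reflection `2E - 1` along a unit vector (`coinC_eq`), and conjugating it by the
diagonal of phases gives another such reflection `2F - 1`, so `evol` is a product of two reflections
(`evol_eq`). On the span of the two axes it is a rotation by an angle `φ`, with `cos φ = 1 - 2 m
gap` and `m = sin² (θ / 2)`. On the line orthogonal to both axes it is the identity. This eigenvalue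
`1`, present at every momentum, causes the localization.

`reflections_pow` writes the powers as the projection onto that line plus multiples of `cos (t φ)`
and `sin (t φ)`. The oscillating terms average to zero by the Riemann–Lebesgue lemma
(`tendsto_integral_trig_arccos_mul`), and dominated convergence carries the limit through the outer
integral. The limit is thus the mean of the projection. Summing over the signs of the two angles
reduces its entries to a constant plus a multiple of `sin² b / gap` (`symm4_spanNum`). Two
elementary integrals, `integral_inv_sub_mul_cos` and `integral_sin_div_sqrt`, then produce the
arcsine. -/

namespace HexWalk

/-! ### Powers of a product of two reflections. -/

section Reflections

variable {R : Type*} [Ring R] [Algebra ℂ R] {E F : R} {τ : ℂ}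

/-- If `E` and `F` are rank-one projections, this is the projection onto the span of
their ranges. -/
noncomputable def spanProj (E F : R) (τ : ℂ) : R :=
  (1 - τ)⁻¹ • (E + F - E * F - F * E)

/-- With `U` the product of the reflections, `P` the span projection, `K = 2 (F E - E F)` and `cos φ
= 2 τ - 1`, this and `reflections_mul_commutator` read `U P = cos φ P + K` and `U K = cos φ K - sin²
φ P`: a closed linear recursion. -/
theorem reflections_mul_spanProj (hE : E * E = E) (hF : F * F = F) (hEF : E * F * E = τ • E)
    (hFE : F * E * F = τ • F) (hτ : 1 - τ ≠ 0) :
    ((2 : ℂ) • F - 1) * ((2 : ℂ) • E - 1) * spanProj E F τ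
      = (2 * τ - 1) • spanProj E F τ + (2 : ℂ) • (F * E - E * F) := by
  have h1 : F * E * E = F * E := by rw [mul_assoc, hE]
  have h3 : (2 : ℂ) • (F * E - E * F)
      = (1 - τ)⁻¹ • ((1 - τ) • ((2 : ℂ) • (F * E - E * F))) := by
    rw [smul_smul, inv_mul_cancel₀ hτ, one_smul]
  rw [h3, spanProj, smul_comm (2 * τ - 1), ← smul_add, mul_smul_comm]
  congr 1
  simp only [mul_sub, sub_mul, mul_add, smul_mul_assoc, mul_smul_comm, ← mul_assoc,
    hE, hF, hEF, hFE, h1, one_mul, mul_one]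
  module

/-- Both `E` and `F` annihilate `1 - P`, so each reflection acts there as `-1` and the two signs
cancel. -/
theorem reflections_mul_one_sub_spanProj (hE : E * E = E) (hF : F * F = F)
    (hEF : E * F * E = τ • E) (hFE : F * E * F = τ • F) (hτ : 1 - τ ≠ 0) :
    ((2 : ℂ) • F - 1) * ((2 : ℂ) • E - 1) * (1 - spanProj E F τ) = 1 - spanProj E F τ := by
  rw [mul_sub, mul_one, reflections_mul_spanProj hE hF hEF hFE hτ]
  have h3 : ((2 : ℂ) * τ - 1) • spanProj E F τ
      = spanProj E F τ - (2 : ℂ) • (E + F - E * F - F * E) := by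
    rw [spanProj, smul_smul, show (2 * τ - 1) * (1 - τ)⁻¹ = (1 - τ)⁻¹ - 2 by field_simp; ring,
      sub_smul]
  rw [h3]
  simp only [mul_sub, sub_mul, smul_mul_assoc, mul_smul_comm, one_mul, mul_one]
  module

theorem reflections_mul_commutator (hE : E * E = E) (hF : F * F = F) (hEF : E * F * E = τ • E)
    (hFE : F * E * F = τ • F) (hτ : 1 - τ ≠ 0) :
    ((2 : ℂ) • F - 1) * ((2 : ℂ) • E - 1) * ((2 : ℂ) • (F * E - E * F))
      = (2 * τ - 1) • ((2 : ℂ) • (F * E - E * F))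
        + ((2 * τ - 1) ^ 2 - 1) • spanProj E F τ := by
  have h1 : F * E * E = F * E := by rw [mul_assoc, hE]
  rw [spanProj, smul_smul ((2 * τ - 1) ^ 2 - 1),
    show ((2 * τ - 1) ^ 2 - 1) * (1 - τ)⁻¹ = -4 * τ by field_simp; ring]
  simp only [mul_sub, sub_mul, smul_mul_assoc, mul_smul_comm, ← mul_assoc,
    hE, hF, hEF, hFE, h1, one_mul, mul_one]
  module

/-- Powers of the product of two reflections along rank-one projections. -/
theorem reflections_pow (hE : E * E = E) (hF : F * F = F) (hEF : E * F * E = τ • E)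
    (hFE : F * E * F = τ • F) (hτ : 1 - τ ≠ 0) {φ : ℝ} (hcos : (Real.cos φ : ℂ) = 2 * τ - 1)
    (hsin : (Real.sin φ : ℂ) ≠ 0) (t : ℕ) :
    (((2 : ℂ) • F - 1) * ((2 : ℂ) • E - 1)) ^ t
      = 1 - spanProj E F τ + (Real.cos (t * φ) : ℂ) • spanProj E F τ
        + ((Real.sin (t * φ) : ℂ) / Real.sin φ) • ((2 : ℂ) • (F * E - E * F)) := by
  induction t with
  | zero => simp
  | succ n ih =>
    rw [pow_succ', ih, mul_add, mul_add, reflections_mul_one_sub_spanProj hE hF hEF hFE hτ,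
      mul_smul_comm, mul_smul_comm, reflections_mul_spanProj hE hF hEF hFE hτ,
      reflections_mul_commutator hE hF hEF hFE hτ, ← hcos]
    have hsq : (Real.cos φ : ℂ) ^ 2 - 1 = -(Real.sin φ : ℂ) ^ 2 := by
      have := Real.sin_sq_add_cos_sq φ
      have h' : (Real.sin φ : ℂ) ^ 2 + (Real.cos φ : ℂ) ^ 2 = 1 := by exact_mod_cast this
      linear_combination h'
    have h1 : (Real.cos ((n + 1 : ℕ) * φ) : ℂ)
        = Real.cos (n * φ) * Real.cos φ - Real.sin (n * φ) * Real.sin φ := by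
      rw [Nat.cast_succ, add_mul, one_mul, Real.cos_add]; push_cast; ring
    have h2 : (Real.sin ((n + 1 : ℕ) * φ) : ℂ)
        = Real.sin (n * φ) * Real.cos φ + Real.cos (n * φ) * Real.sin φ := by
      rw [Nat.cast_succ, add_mul, one_mul, Real.sin_add]; push_cast; ring
    have h3 : (Real.sin (n * φ) : ℂ) / Real.sin φ * (-(Real.sin φ : ℂ) ^ 2)
        = -(Real.sin (n * φ) * Real.sin φ) := by field_simp
    have h4 : (Real.sin (n * φ) * Real.cos φ + Real.cos (n * φ) * Real.sin φ : ℂ) / Real.sin φ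
        = Real.sin (n * φ) / Real.sin φ * Real.cos φ + Real.cos (n * φ) := by field_simp
    rw [h1, h2, hsq, h4, smul_add, smul_add, smul_smul (_ / _) (-_), h3]
    module

end Reflections

/-! ### Oscillatory integrals and two explicit integrals. -/

section Integrals

open MeasureTheory

/-- The Riemann–Lebesgue lemma for a phase function without critical points. -/
theorem tendsto_setIntegral_exp_mul (g : ℝ → ℂ) {φ φ' : ℝ → ℝ} {s : Set ℝ}
    (hs : MeasurableSet s) (hφ : ∀ x ∈ s, HasDerivWithinAt φ (φ' x) s x)
    (hinj : Set.InjOn φ s) (hne : ∀ x ∈ s, φ' x ≠ 0) :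
    Tendsto (fun t : ℝ => ∫ x in s, Complex.exp (t * φ x * Complex.I) * g x)
      (cocompact ℝ) (𝓝 0) := by
  -- The density of `g` after the substitution `u = φ x`, which turns the integral into a Fourier
  -- transform over the image of `s`.
  let h : ℝ → ℂ := fun u =>
    (|φ' (Function.invFunOn φ s u)|⁻¹ : ℝ) • g (Function.invFunOn φ s u)
  have himg : MeasurableSet (φ '' s) :=
    measurable_image_of_fderivWithin hs (fun x hx => (hφ x hx).hasFDerivWithinAt) hinj
  have key := Real.tendsto_integral_exp_smul_cocompact ((φ '' s).indicator h)
  -- The Fourier character is `exp (-2πi v w)`; the frequency `w = -t / (2π)` gives `exp (i t v)`.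
  have hlin : Tendsto (fun t : ℝ => (-(2 * Real.pi))⁻¹ * t) (cocompact ℝ) (cocompact ℝ) :=
    (Homeomorph.mulLeft₀ ((-(2 * Real.pi))⁻¹)
      (inv_ne_zero (neg_ne_zero.2 Real.two_pi_pos.ne'))).isClosedEmbedding.tendsto_cocompact
  refine (key.comp hlin).congr fun t => ?_
  have hpi : (Real.pi : ℂ) ≠ 0 := by exact_mod_cast Real.pi_ne_zero
  have h1 : ∀ v : ℝ, Real.fourierChar (-(v * ((-(2 * Real.pi))⁻¹ * t))) • (φ '' s).indicator h v
      = (φ '' s).indicator (fun v => Complex.exp (t * v * Complex.I) * h v) v := by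
    intro v
    by_cases hv : v ∈ φ '' s
    · rw [Set.indicator_of_mem hv, Set.indicator_of_mem hv, Circle.smul_def,
        Real.fourierChar_apply, smul_eq_mul]
      congr 2
      push_cast
      field_simp
    · rw [Set.indicator_of_notMem hv, Set.indicator_of_notMem hv, smul_zero]
  simp only [Function.comp_apply, h1]
  rw [integral_indicator himg, integral_image_eq_integral_abs_deriv_smul hs hφ hinj]
  refine setIntegral_congr_fun hs fun x hx => ?_
  have hinv : Function.invFunOn φ s (φ x) = x := hinj.leftInvOn_invFunOn hx
  have habs : ((|φ' x| : ℝ) : ℂ) ≠ 0 := by exact_mod_cast abs_ne_zero.2 (hne x hx)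
  simp only [h, hinv, Complex.real_smul]
  push_cast
  field_simp

/-- The half-angle tangent primitive is singular at `π`. The form used here is smooth on the whole
line, and its arctangent term vanishes at both endpoints. -/
theorem integral_inv_sub_mul_cos {p q r : ℝ} (hr : 0 < r) (hp : 0 < p)
    (h : r ^ 2 = p ^ 2 - q ^ 2) :
    ∫ a in (0 : ℝ)..Real.pi, (p - q * Real.cos a)⁻¹ = Real.pi / r := by
  have hqp : |q| < p := abs_lt_of_sq_lt_sq (by nlinarith [sq_pos_of_pos hr]) hp.le
  have hle : ∀ a : ℝ, q * Real.cos a ≤ |q| := fun a => by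
    calc q * Real.cos a ≤ |q * Real.cos a| := le_abs_self _
      _ = |q| * |Real.cos a| := abs_mul _ _
      _ ≤ |q| * 1 := by gcongr; exact Real.abs_cos_le_one a
      _ = |q| := mul_one _
  have hpos : ∀ a : ℝ, 0 < p - q * Real.cos a := fun a => by linarith [hle a]
  have hpos' : ∀ a : ℝ, 0 < p + r - q * Real.cos a := fun a => by linarith [hpos a]
  have hder : ∀ a : ℝ, HasDerivAt
      (fun a => (a + 2 * Real.arctan (q * Real.sin a / (p + r - q * Real.cos a))) / r)
      (p - q * Real.cos a)⁻¹ a := by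
    intro a
    have hd := (((hasDerivAt_id a).add (((((Real.hasDerivAt_sin a).const_mul q).div
      (((Real.hasDerivAt_cos a).const_mul q).const_sub (p + r)) (hpos' a).ne').arctan).const_mul
        2)).div_const r)
    refine hd.congr_deriv ?_
    have h1 := (hpos a).ne'
    have h2 := (hpos' a).ne'
    have h3 : (p + r - q * Real.cos a) ^ 2 + (q * Real.sin a) ^ 2
        = 2 * (p + r) * (p - q * Real.cos a) := by
      have := Real.sin_sq_add_cos_sq a
      linear_combination q ^ 2 * this + h
    have h4 : 1 + (q * Real.sin a / (p + r - q * Real.cos a)) ^ 2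
        = 2 * (p + r) * (p - q * Real.cos a) / (p + r - q * Real.cos a) ^ 2 := by
      rw [← h3]; field_simp
    have h5 : p + r ≠ 0 := by positivity
    simp only [Pi.div_apply, h4]
    field_simp
    have := Real.sin_sq_add_cos_sq a
    linear_combination (-q ^ 2) * this - h
  rw [intervalIntegral.integral_eq_sub_of_hasDerivAt (fun a _ => hder a)]
  · simp
  · exact (Continuous.inv₀ (by fun_prop) fun a => (hpos a).ne').intervalIntegrable _ _

theorem sq_mul_cos_lt {m k : ℝ} (hm : 0 < m) (hk : m < k) (b : ℝ) :
    0 < k ^ 2 - m ^ 2 * Real.cos b ^ 2 := by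
  have := Real.cos_sq_le_one b
  nlinarith [sq_pos_of_pos hm]

/-- The substitution `u = (m / k) cos b` leads to the derivative of the arcsine. -/
theorem integral_sin_div_sqrt {m k : ℝ} (hm : 0 < m) (hk : m < k) :
    ∫ b in (0 : ℝ)..Real.pi, Real.sin b / √(k ^ 2 - m ^ 2 * Real.cos b ^ 2)
      = 2 / m * Real.arcsin (m / k) := by
  have hk0 : 0 < k := hm.trans hk
  have hpos := sq_mul_cos_lt hm hk
  have hder : ∀ b : ℝ, HasDerivAt (fun b => -Real.arcsin (m / k * Real.cos b) / m)
      (Real.sin b / √(k ^ 2 - m ^ 2 * Real.cos b ^ 2)) b := by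
    intro b
    have hlt : |m / k * Real.cos b| < 1 := by
      rw [abs_mul, abs_of_pos (by positivity)]
      calc m / k * |Real.cos b| ≤ m / k * 1 := by gcongr; exact Real.abs_cos_le_one b
        _ < 1 := by rw [mul_one, div_lt_one hk0]; exact hk
    rw [abs_lt] at hlt
    have hd := (((Real.hasDerivAt_arcsin hlt.1.ne' hlt.2.ne).comp b
      ((Real.hasDerivAt_cos b).const_mul (m / k))).neg).div_const m
    refine hd.congr_deriv ?_
    have h1 : 1 - (m / k * Real.cos b) ^ 2 = (k ^ 2 - m ^ 2 * Real.cos b ^ 2) / k ^ 2 := by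
      field_simp
    rw [h1, Real.sqrt_div (hpos b).le, Real.sqrt_sq hk0.le]
    have := (Real.sqrt_pos.2 (hpos b)).ne'
    field_simp
  rw [intervalIntegral.integral_eq_sub_of_hasDerivAt (fun b _ => hder b)]
  · simp [Real.arcsin_neg]; ring
  · refine (Continuous.div (by fun_prop) (by fun_prop) fun b => ?_).intervalIntegrable _ _
    exact (Real.sqrt_pos.2 (hpos b)).ne'

end Integrals

/-! ### The walk in Fourier space. -/

section Fourier

open MeasureTheory

/-- The mean of a function of two angles, the second argument being integrated first. -/
noncomputable def avg (f : ℝ → ℝ → ℂ) : ℂ :=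
  (4 * (Real.pi : ℂ) ^ 2)⁻¹ * ∫ b in -Real.pi..Real.pi, ∫ a in -Real.pi..Real.pi, f b a

theorem avg_const_mul (z : ℂ) (f : ℝ → ℝ → ℂ) :
    avg (fun b a => z * f b a) = z * avg f := by
  simp only [avg, intervalIntegral.integral_const_mul]
  ring

theorem avg_add {f g : ℝ → ℝ → ℂ} (hf : Continuous f.uncurry) (hg : Continuous g.uncurry) :
    avg (fun b a => f b a + g b a) = avg f + avg g := by
  have hf' := intervalIntegral.continuous_parametric_intervalIntegral_of_continuous'
    (μ := volume) hf (-Real.pi) Real.pi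
  have hg' := intervalIntegral.continuous_parametric_intervalIntegral_of_continuous'
    (μ := volume) hg (-Real.pi) Real.pi
  have h1 : ∀ b, ∫ a in -Real.pi..Real.pi, (f b a + g b a)
      = (∫ a in -Real.pi..Real.pi, f b a) + ∫ a in -Real.pi..Real.pi, g b a := fun b =>
    intervalIntegral.integral_add (hf.uncurry_left b |>.intervalIntegrable _ _)
      (hg.uncurry_left b |>.intervalIntegrable _ _)
  simp only [avg, h1]
  rw [intervalIntegral.integral_add (hf'.intervalIntegrable _ _) (hg'.intervalIntegrable _ _),
    mul_add]

theorem avg_sum_mul {f : Fin 3 → ℝ → ℝ → ℂ} (hf : ∀ k, Continuous (f k).uncurry)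
    (z : Fin 3 → ℂ) : avg (fun b a => ∑ k, z k * f k b a) = ∑ k, z k * avg (f k) := by
  have hz : ∀ k, Continuous (Function.uncurry fun b a => z k * f k b a) :=
    fun k => continuous_const.mul (hf k)
  have h01 : Continuous (Function.uncurry fun b a => z 0 * f 0 b a + z 1 * f 1 b a) :=
    (hz 0).add (hz 1)
  simp only [Fin.sum_univ_three]
  rw [avg_add h01 (hz 2), avg_add (hz 0) (hz 1)]
  simp only [avg_const_mul]

theorem integral_exp_int_mul (n : ℤ) :
    ∫ a in -Real.pi..Real.pi, Complex.exp (n * a * Complex.I)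
      = if n = 0 then 2 * (Real.pi : ℂ) else 0 := by
  split_ifs with h
  · simp [h]; ring
  · have hn : (n : ℂ) * Complex.I ≠ 0 := mul_ne_zero (by exact_mod_cast h) Complex.I_ne_zero
    have h1 : ∀ a : ℝ, Complex.exp (n * a * Complex.I) = Complex.exp (n * Complex.I * a) :=
      fun a => by ring_nf
    simp only [h1]
    rw [integral_exp_mul_complex hn]
    have h2 : Complex.exp (n * Complex.I * (Real.pi : ℝ))
        = Complex.exp (n * Complex.I * (-Real.pi : ℝ)) := by
      rw [Complex.exp_eq_exp_iff_exists_int]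
      exact ⟨n, by push_cast; ring⟩
    rw [h2, sub_self, zero_div]

/-- The plane wave attached to a vertex. -/
noncomputable def Site.wave : Site → ℝ → ℝ → ℂ
  | .one x y, b, a => Complex.exp (x * a * Complex.I) * Complex.exp (y * b * Complex.I)
  | .two x y, b, a => Complex.exp (x * a * Complex.I) * Complex.exp (y * b * Complex.I)

theorem Site.continuous_wave (v : Site) : Continuous v.wave.uncurry := by
  cases v <;> simp only [Function.uncurry_def, Site.wave] <;> fun_prop

/-- Orthogonality of characters: the initial state sits at the origin, so its Fourier transform is
constant. -/
theorem avg_wave_one (x y : ℤ) :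
    avg (Site.one x y).wave = if x = 0 ∧ y = 0 then 1 else 0 := by
  have hpi : (Real.pi : ℂ) ≠ 0 := by exact_mod_cast Real.pi_ne_zero
  simp only [avg, Site.wave, intervalIntegral.integral_mul_const,
    intervalIntegral.integral_const_mul, integral_exp_int_mul]
  by_cases hx : x = 0 <;> by_cases hy : y = 0 <;> simp [hx, hy]
  field_simp
  norm_num

/-- The phases acquired by the three coin states in a shift. -/
noncomputable def phase (b a : ℝ) : Fin 3 → ℂ :=
  ![Complex.exp (-b * Complex.I), Complex.exp (a * Complex.I), Complex.exp (b * Complex.I)]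

theorem phase_neg (b a : ℝ) (j : Fin 3) : phase (-b) (-a) j = star (phase b a j) := by
  fin_cases j <;> simp [phase, ← Complex.exp_conj]

theorem continuous_phase (j : Fin 3) : Continuous fun p : ℝ × ℝ => phase p.1 p.2 j := by
  fin_cases j <;> simp [phase] <;> fun_prop

theorem phase_mul_phase_neg (b a : ℝ) (j : Fin 3) : phase b a j * phase (-b) (-a) j = 1 := by
  fin_cases j <;> simp [phase, ← Complex.exp_add]

/-- Both sublattices carry the same exponential in their integer coordinates, so a move costs only
the phase of the change in these coordinates. The reverse move costs the inverse phase. -/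
theorem Site.wave_move_two (x y : ℤ) (j : Fin 3) (b a : ℝ) :
    ((Site.two x y).move j).wave b a = (Site.two x y).wave b a * phase b a j := by
  fin_cases j <;> simp only [Site.move, Site.wave, phase, ← Complex.exp_add] <;>
    simp [← Complex.exp_add] <;> ring_nf

theorem Site.wave_move_one (x y : ℤ) (j : Fin 3) (b a : ℝ) :
    ((Site.one x y).move j).wave b a = (Site.one x y).wave b a * phase (-b) (-a) j := by
  fin_cases j <;> simp only [Site.move, Site.wave, phase, ← Complex.exp_add] <;>
    simp [← Complex.exp_add] <;> ring_nf

/-- A move along an edge is an involution, so the amplitude arriving at `v` along edge `j` comes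
from `v.move j`. -/
theorem shift_coin_apply (θ : ℝ) (Ψ : State) (v : Site) (j : Fin 3) :
    (S₁ + S₂) (coin θ Ψ) (v, j) = ∑ k, (coinMatrix θ j k : ℂ) * Ψ (v.move j, k) := by
  change S₁ (coin θ Ψ) (v, j) + S₂ (coin θ Ψ) (v, j) = _
  cases v <;> simp [S₁, S₂, coin, Site.inOne, Site.inTwo]

theorem initial_apply (α β γ : ℂ) (v : Site) (j : Fin 3) :
    initial α β γ (v, j) = if v = origin then ![α, β, γ] j else 0 := by
  change α * ket origin 0 (v, j) + β * ket origin 1 (v, j) + γ * ket origin 2 (v, j) = _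
  by_cases h : v = origin <;> fin_cases j <;> simp [ket, lp.single_apply, h]

theorem avg_wave_sum_mul {g : ℝ → ℝ → Fin 3 → ℂ}
    (hg : ∀ k, Continuous fun p : ℝ × ℝ => g p.1 p.2 k) (v : Site) (z : Fin 3 → ℂ) :
    avg (fun b a => v.wave b a * ∑ k, z k * g b a k)
      = ∑ k, z k * avg (fun b a => v.wave b a * g b a k) := by
  have hc : ∀ k, Continuous (Function.uncurry fun b a => v.wave b a * g b a k) :=
    fun k => v.continuous_wave.mul (hg k)
  rw [← avg_sum_mul hc]
  simp only [Finset.mul_sum, mul_left_comm]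

/-- A step of the walk from `ℍ₁` to `ℍ₂` in Fourier space. -/
theorem step_one {θ : ℝ} {Ψ : State} {g : ℝ → ℝ → Fin 3 → ℂ}
    (hg : ∀ k, Continuous fun p : ℝ × ℝ => g p.1 p.2 k)
    (h₁ : ∀ x y j, Ψ (.one x y, j) = avg fun b a => (Site.one x y).wave b a * g b a j)
    (h₂ : ∀ x y j, Ψ (.two x y, j) = 0) :
    (∀ x y j, (S₁ + S₂) (coin θ Ψ) (.two x y, j) = avg fun b a => (Site.two x y).wave b a
      * (phase b a j * ∑ k, (coinMatrix θ j k : ℂ) * g b a k)) ∧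
    ∀ x y j, (S₁ + S₂) (coin θ Ψ) (.one x y, j) = 0 := by
  have h₁' : ∀ x y j k, Ψ ((Site.two x y).move j, k)
      = avg fun b a => ((Site.two x y).move j).wave b a * g b a k := by
    intro x y j k; fin_cases j <;> exact h₁ _ _ _
  have h₂' : ∀ x y j k, Ψ ((Site.one x y).move j, k) = 0 := by
    intro x y j k; fin_cases j <;> exact h₂ _ _ _
  refine ⟨fun x y j => ?_, fun x y j => ?_⟩
  · rw [shift_coin_apply]
    simp only [h₁', ← mul_assoc (Site.wave _ _ _), ← Site.wave_move_two]
    rw [avg_wave_sum_mul hg]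
  · rw [shift_coin_apply]
    simp [h₂']

/-- A step of the walk from `ℍ₂` to `ℍ₁` in Fourier space. -/
theorem step_two {θ : ℝ} {Ψ : State} {g : ℝ → ℝ → Fin 3 → ℂ}
    (hg : ∀ k, Continuous fun p : ℝ × ℝ => g p.1 p.2 k)
    (h₁ : ∀ x y j, Ψ (.two x y, j) = avg fun b a => (Site.two x y).wave b a * g b a j)
    (h₂ : ∀ x y j, Ψ (.one x y, j) = 0) :
    (∀ x y j, (S₁ + S₂) (coin θ Ψ) (.one x y, j) = avg fun b a => (Site.one x y).wave b a
      * (phase (-b) (-a) j * ∑ k, (coinMatrix θ j k : ℂ) * g b a k)) ∧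
    ∀ x y j, (S₁ + S₂) (coin θ Ψ) (.two x y, j) = 0 := by
  have h₁' : ∀ x y j k, Ψ ((Site.one x y).move j, k)
      = avg fun b a => ((Site.one x y).move j).wave b a * g b a k := by
    intro x y j k; fin_cases j <;> exact h₁ _ _ _
  have h₂' : ∀ x y j k, Ψ ((Site.two x y).move j, k) = 0 := by
    intro x y j k; fin_cases j <;> exact h₂ _ _ _
  refine ⟨fun x y j => ?_, fun x y j => ?_⟩
  · rw [shift_coin_apply]
    simp only [h₁', ← mul_assoc (Site.wave _ _ _), ← Site.wave_move_one]
    rw [avg_wave_sum_mul hg]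
  · rw [shift_coin_apply]
    simp [h₂']

/-- The coin matrix over the complex numbers. -/
noncomputable def coinC (θ : ℝ) : Matrix (Fin 3) (Fin 3) ℂ := (coinMatrix θ).map (↑)

/-- The two-step evolution in Fourier space. -/
noncomputable def evol (θ b a : ℝ) : Matrix (Fin 3) (Fin 3) ℂ :=
  Matrix.diagonal (phase (-b) (-a)) * coinC θ * (Matrix.diagonal (phase b a) * coinC θ)

theorem evol_mulVec (θ b a : ℝ) (ψ : Fin 3 → ℂ) (j : Fin 3) :
    (evol θ b a).mulVec ψ j = phase (-b) (-a) j * ∑ k, (coinMatrix θ j k : ℂ)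
      * (phase b a k * ∑ l, (coinMatrix θ k l : ℂ) * ψ l) := by
  have hC : ∀ w j, (coinC θ).mulVec w j = ∑ k, (coinMatrix θ j k : ℂ) * w k := by
    simp [Matrix.mulVec, dotProduct, coinC]
  simp only [evol, ← Matrix.mulVec_mulVec, Matrix.mulVec_diagonal, hC]

theorem continuous_evol_pow (θ : ℝ) (t : ℕ) :
    Continuous fun p : ℝ × ℝ => evol θ p.1 p.2 ^ t := by
  have h1 : Continuous fun p : ℝ × ℝ => phase p.1 p.2 := continuous_pi continuous_phase
  have h2 : Continuous fun p : ℝ × ℝ => phase (-p.1) (-p.2) :=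
    h1.comp (continuous_fst.neg.prodMk continuous_snd.neg)
  unfold evol
  exact (((h2.matrix_diagonal).mul continuous_const).mul
    ((h1.matrix_diagonal).mul continuous_const)).pow t

theorem continuous_evol_pow_mulVec (θ : ℝ) (t : ℕ) (ψ : Fin 3 → ℂ) (j : Fin 3) :
    Continuous fun p : ℝ × ℝ => (evol θ p.1 p.2 ^ t).mulVec ψ j :=
  (continuous_apply j).comp ((continuous_evol_pow θ t).matrix_mulVec continuous_const)

/-- Induction by pairs of steps; the vanishing on the other sublattice must be carried along, since
`step_one` requires it. -/
theorem walk_even (θ : ℝ) (α β γ : ℂ) (t : ℕ) :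
    (∀ x y j, walk θ α β γ (2 * t) (.one x y, j) = avg fun b a => (Site.one x y).wave b a
      * (evol θ b a ^ t).mulVec ![α, β, γ] j) ∧
    ∀ x y j, walk θ α β γ (2 * t) (.two x y, j) = 0 := by
  induction t with
  | zero =>
    refine ⟨fun x y j => ?_, fun x y j => ?_⟩
    · simp only [pow_zero, Matrix.one_mulVec, mul_comm (Site.wave _ _ _)]
      rw [avg_const_mul, avg_wave_one]
      simp [walk, initial_apply, origin]
    · simp [walk, initial_apply, origin]
  | succ t ih =>
    have s1 := step_one (θ := θ) (continuous_evol_pow_mulVec θ t ![α, β, γ]) ih.1 ih.2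
    have hg : ∀ j, Continuous fun p : ℝ × ℝ => phase p.1 p.2 j * ∑ k, (coinMatrix θ j k : ℂ)
        * (evol θ p.1 p.2 ^ t).mulVec ![α, β, γ] k := fun j =>
      (continuous_phase j).mul (continuous_finsetSum _ fun k _ =>
        continuous_const.mul (continuous_evol_pow_mulVec θ t ![α, β, γ] k))
    have s2 := step_two (θ := θ) hg s1.1 s1.2
    simp only [← evol_mulVec, Matrix.mulVec_mulVec, ← pow_succ'] at s2
    exact s2

theorem walk_odd_one (θ : ℝ) (α β γ : ℂ) (t : ℕ) (x y : ℤ) (j : Fin 3) :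
    walk θ α β γ (2 * t + 1) (.one x y, j) = 0 :=
  (step_one (continuous_evol_pow_mulVec θ t ![α, β, γ]) (walk_even θ α β γ t).1
    (walk_even θ α β γ t).2).2 x y j

theorem prob_origin (θ : ℝ) (α β γ : ℂ) (t : ℕ) :
    prob θ α β γ t (0, 0) = ∑ j, ‖walk θ α β γ t (origin, j)‖ ^ 2 := by
  rw [prob, tsum_eq_single ⟨origin, pos_origin⟩]
  rintro ⟨v, hv⟩ hne
  exact absurd (Subtype.ext (Site.pos_injective (hv.trans pos_origin.symm))) hne

theorem walk_even_origin (θ : ℝ) (α β γ : ℂ) (t : ℕ) (j : Fin 3) :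
    walk θ α β γ (2 * t) (origin, j)
      = ∑ k, ![α, β, γ] k * avg fun b a => (evol θ b a ^ t) j k := by
  have hc : ∀ k, Continuous (Function.uncurry fun b a => (evol θ b a ^ t) j k) := fun k =>
    (continuous_evol_pow θ t).matrix_elem j k
  rw [← avg_sum_mul hc, origin, (walk_even θ α β γ t).1]
  simp [Site.wave, Matrix.mulVec, dotProduct, mul_comm]

end Fourier

/-! ### The two axes, their overlap, and the symmetrized projection. -/

section Spectrum

/-- The axis of the reflection given by the coin. -/
noncomputable def coinVec (θ : ℝ) : Fin 3 → ℂ :=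
  ![((Real.sin (θ / 2) / √2 : ℝ) : ℂ), (Real.cos (θ / 2) : ℂ),
    ((Real.sin (θ / 2) / √2 : ℝ) : ℂ)]

theorem coinVec_zero_sq (θ : ℝ) : coinVec θ 0 ^ 2 = ((Real.sin (θ / 2) ^ 2 / 2 : ℝ) : ℂ) := by
  have h : (Real.sin (θ / 2) / √2) ^ 2 = Real.sin (θ / 2) ^ 2 / 2 := by
    rw [div_pow, Real.sq_sqrt (by norm_num)]
  simp only [coinVec, Matrix.cons_val_zero]
  rw [← h, Complex.ofReal_pow]

theorem coinVec_two (θ : ℝ) : coinVec θ 2 = coinVec θ 0 := rfl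

theorem coinVec_one_sq (θ : ℝ) : coinVec θ 1 ^ 2 = 1 - 2 * coinVec θ 0 ^ 2 := by
  rw [coinVec_zero_sq]
  have h := Real.sin_sq_add_cos_sq (θ / 2)
  simp only [coinVec, Matrix.cons_val_one, Matrix.cons_val_zero]
  have h' : (Real.cos (θ / 2) : ℂ) ^ 2 = ((1 - Real.sin (θ / 2) ^ 2 : ℝ) : ℂ) := by
    rw [← h]; push_cast; ring
  rw [h']; push_cast; ring

theorem star_coinVec (θ : ℝ) (j : Fin 3) : star (coinVec θ j) = coinVec θ j := by
  fin_cases j <;> simp only [coinVec] <;> exact Complex.conj_ofReal _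

/-- The projection onto the axis of the coin. -/
noncomputable def coinProj (θ : ℝ) : Matrix (Fin 3) (Fin 3) ℂ :=
  Matrix.vecMulVec (coinVec θ) (coinVec θ)

/-- The projection onto the axis of the coin conjugated by the shift. -/
noncomputable def shiftedProj (θ b a : ℝ) : Matrix (Fin 3) (Fin 3) ℂ :=
  Matrix.vecMulVec (fun j => phase (-b) (-a) j * coinVec θ j)
    (fun j => phase b a j * coinVec θ j)

/-- Half-angle formulas applied entry by entry; `θ / 2` is the angle between the axis and the middle
basis vector. -/
theorem coinC_eq (θ : ℝ) : coinC θ = (2 : ℂ) • coinProj θ - 1 := by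
  have h2 : ((√2 : ℝ) : ℂ) ^ 2 = 2 := by
    rw [← Complex.ofReal_pow, Real.sq_sqrt (by norm_num)]; norm_num
  have h20 : ((√2 : ℝ) : ℂ) ≠ 0 := by
    exact_mod_cast (Real.sqrt_pos.2 (by norm_num : (0:ℝ) < 2)).ne'
  have hc : (Real.cos θ : ℂ) = 2 * (Real.cos (θ / 2) : ℂ) ^ 2 - 1 := by
    rw [← mul_div_cancel₀ θ (two_ne_zero' ℝ), Real.cos_two_mul,
      mul_div_cancel₀ θ (two_ne_zero' ℝ)]
    push_cast; ring
  have hs : (Real.sin θ : ℂ) = 2 * (Real.sin (θ / 2) : ℂ) * (Real.cos (θ / 2) : ℂ) := by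
    rw [← mul_div_cancel₀ θ (two_ne_zero' ℝ), Real.sin_two_mul,
      mul_div_cancel₀ θ (two_ne_zero' ℝ)]
    push_cast; ring
  have h1 : (Real.sin (θ / 2) : ℂ) ^ 2 = 1 - (Real.cos (θ / 2) : ℂ) ^ 2 := by
    have h := Real.sin_sq_add_cos_sq (θ / 2)
    rw [eq_sub_iff_add_eq]; exact_mod_cast h
  ext j k
  simp only [coinC, coinMatrix, coinProj, Matrix.map_apply, Matrix.sub_apply, Matrix.smul_apply,
    Matrix.vecMulVec_apply, coinVec]
  fin_cases j <;> fin_cases k <;>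
    simp [-Complex.ofReal_cos, -Complex.ofReal_sin, hc, hs] <;> field_simp <;>
    (try rw [h2]) <;> (try simp only [h1]) <;> ring

/-- The two diagonal matrices of phases are mutually inverse, so they conjugate the first coin into
a reflection along a rephased axis. -/
theorem evol_eq (θ b a : ℝ) :
    evol θ b a = ((2 : ℂ) • shiftedProj θ b a - 1) * ((2 : ℂ) • coinProj θ - 1) := by
  rw [evol, ← mul_assoc, coinC_eq]
  congr 1
  ext j k
  simp only [Matrix.diagonal_mul, Matrix.mul_diagonal, shiftedProj, coinProj, Matrix.sub_apply,
    Matrix.smul_apply, Matrix.vecMulVec_apply, smul_eq_mul]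
  by_cases h : j = k
  · subst h
    simp only [Matrix.one_apply_eq]
    linear_combination -phase_mul_phase_neg b a j
  · simp only [Matrix.one_apply_ne h]; ring

/-- The denominator of the averaged projection. -/
noncomputable def gap (m b a : ℝ) : ℝ :=
  2 * (1 - m) * (1 - Real.cos a * Real.cos b) + m * Real.sin b ^ 2

/-- The scalar product of the axes of the two reflections. -/
noncomputable def overlap (θ b a : ℝ) : ℂ :=
  ∑ j, coinVec θ j ^ 2 * phase (-b) (-a) j

theorem coinVec_dotProduct (θ : ℝ) : dotProduct (coinVec θ) (coinVec θ) = 1 := by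
  simp only [dotProduct, Fin.sum_univ_three, coinVec_two]
  linear_combination coinVec_one_sq θ

theorem coinProj_mul_self (θ : ℝ) : coinProj θ * coinProj θ = coinProj θ := by
  rw [coinProj, Matrix.vecMulVec_mul_vecMulVec, coinVec_dotProduct, one_smul]

theorem shiftedProj_mul_self (θ b a : ℝ) :
    shiftedProj θ b a * shiftedProj θ b a = shiftedProj θ b a := by
  rw [shiftedProj, Matrix.vecMulVec_mul_vecMulVec]
  have h : dotProduct (fun j => phase b a j * coinVec θ j)
      (fun j => phase (-b) (-a) j * coinVec θ j) = 1 := by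
    rw [← coinVec_dotProduct θ]
    refine Finset.sum_congr rfl fun j _ => ?_
    linear_combination coinVec θ j ^ 2 * phase_mul_phase_neg b a j
  rw [h, one_smul]

theorem coinProj_mul_shiftedProj (θ b a : ℝ) : coinProj θ * shiftedProj θ b a
    = overlap θ b a • Matrix.vecMulVec (coinVec θ) (fun j => phase b a j * coinVec θ j) := by
  rw [shiftedProj, coinProj, Matrix.vecMulVec_mul_vecMulVec, Matrix.vecMulVec_smul]
  congr 1
  simp only [dotProduct, overlap]
  refine Finset.sum_congr rfl fun j _ => ?_
  ring

theorem shiftedProj_mul_coinProj (θ b a : ℝ) : shiftedProj θ b a * coinProj θ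
    = overlap θ (-b) (-a) •
      Matrix.vecMulVec (fun j => phase (-b) (-a) j * coinVec θ j) (coinVec θ) := by
  rw [shiftedProj, coinProj, Matrix.vecMulVec_mul_vecMulVec, Matrix.vecMulVec_smul]
  congr 1
  simp only [dotProduct, overlap]
  refine Finset.sum_congr rfl fun j _ => ?_
  rw [neg_neg, neg_neg]
  ring

theorem exp_neg_mul_I (x : ℝ) : Complex.exp (-x * Complex.I) = (Complex.exp (x * Complex.I))⁻¹ := by
  rw [neg_mul, Complex.exp_neg]

theorem cos_eq_exp (x : ℝ) : (Real.cos x : ℂ)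
    = (Complex.exp (x * Complex.I) + (Complex.exp (x * Complex.I))⁻¹) / 2 := by
  rw [← exp_neg_mul_I, Complex.ofReal_cos, Complex.cos]

theorem sin_sq_eq_exp (x : ℝ) : (Real.sin x : ℂ) ^ 2
    = 1 - ((Complex.exp (x * Complex.I) + (Complex.exp (x * Complex.I))⁻¹) / 2) ^ 2 := by
  rw [← cos_eq_exp, eq_sub_iff_add_eq]
  exact_mod_cast Real.sin_sq_add_cos_sq x

theorem gap_eq_exp (θ b a : ℝ) : (gap (Real.sin (θ / 2) ^ 2) b a : ℂ)
    = 2 * (1 - 2 * coinVec θ 0 ^ 2) * (1 - (Complex.exp (a * Complex.I)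
        + (Complex.exp (a * Complex.I))⁻¹) / 2 * ((Complex.exp (b * Complex.I)
        + (Complex.exp (b * Complex.I))⁻¹) / 2)) + 2 * coinVec θ 0 ^ 2 *
        (1 - ((Complex.exp (b * Complex.I) + (Complex.exp (b * Complex.I))⁻¹) / 2) ^ 2) := by
  rw [← sin_sq_eq_exp, ← cos_eq_exp, ← cos_eq_exp, coinVec_zero_sq, gap]
  push_cast
  ring

theorem overlap_eq_exp (θ b a : ℝ) : overlap θ b a
    = coinVec θ 0 ^ 2 * (Complex.exp (b * Complex.I) + (Complex.exp (b * Complex.I))⁻¹)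
      + (1 - 2 * coinVec θ 0 ^ 2) * (Complex.exp (a * Complex.I))⁻¹ := by
  simp only [overlap, Fin.sum_univ_three, coinVec_two, coinVec_one_sq, phase, Matrix.cons_val_zero,
    Matrix.cons_val_one, Matrix.cons_val, Complex.ofReal_neg, neg_neg, exp_neg_mul_I]
  ring

/-- Negating both angles conjugates the overlap, so the product is its squared modulus, the
parameter `τ` of the two reflections. In `exp (i a)` and `exp (i b)` it is a rational identity. -/
theorem overlap_mul_overlap_neg (θ b a : ℝ) : overlap θ b a * overlap θ (-b) (-a)
    = ((1 - Real.sin (θ / 2) ^ 2 * gap (Real.sin (θ / 2) ^ 2) b a : ℝ) : ℂ) := by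
  have hu : ((Real.sin (θ / 2) ^ 2 : ℝ) : ℂ) = 2 * coinVec θ 0 ^ 2 := by
    rw [coinVec_zero_sq]; push_cast; ring
  rw [Complex.ofReal_sub, Complex.ofReal_mul, gap_eq_exp, hu, overlap_eq_exp, overlap_eq_exp]
  simp only [Complex.ofReal_neg, exp_neg_mul_I, inv_inv, Complex.ofReal_one]
  have ha := Complex.exp_ne_zero (a * Complex.I)
  have hb := Complex.exp_ne_zero (b * Complex.I)
  generalize Complex.exp (a * Complex.I) = x at *
  generalize Complex.exp (b * Complex.I) = y at *
  field_simp
  ring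

theorem coinProj_mul_shiftedProj_mul (θ b a : ℝ) :
    coinProj θ * shiftedProj θ b a * coinProj θ
      = ((1 - Real.sin (θ / 2) ^ 2 * gap (Real.sin (θ / 2) ^ 2) b a : ℝ) : ℂ) • coinProj θ := by
  rw [← overlap_mul_overlap_neg, coinProj_mul_shiftedProj, smul_mul_assoc, mul_smul]
  congr 1
  rw [coinProj, Matrix.vecMulVec_mul_vecMulVec, Matrix.vecMulVec_smul]
  congr 1
  simp only [dotProduct, overlap]
  refine Finset.sum_congr rfl fun j _ => ?_
  rw [neg_neg, neg_neg]
  ring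

theorem shiftedProj_mul_coinProj_mul (θ b a : ℝ) :
    shiftedProj θ b a * coinProj θ * shiftedProj θ b a
      = ((1 - Real.sin (θ / 2) ^ 2 * gap (Real.sin (θ / 2) ^ 2) b a : ℝ) : ℂ)
        • shiftedProj θ b a := by
  rw [← overlap_mul_overlap_neg, shiftedProj_mul_coinProj, smul_mul_assoc, mul_comm, mul_smul]
  congr 1
  rw [shiftedProj, Matrix.vecMulVec_mul_vecMulVec, Matrix.vecMulVec_smul]
  congr 1
  simp only [dotProduct, overlap]
  refine Finset.sum_congr rfl fun j _ => ?_
  ring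

/-- The sum of a function over the reflections of its two arguments. -/
def symm4 (f : ℝ → ℝ → ℂ) (b a : ℝ) : ℂ := f b a + f b (-a) + (f (-b) a + f (-b) (-a))

/-- The part of the averaged projection that does not depend on `θ`. -/
noncomputable def limConst : Matrix (Fin 3) (Fin 3) ℂ :=
  !![1 / 2, 0, -1 / 2; 0, 0, 0; -1 / 2, 0, 1 / 2]

/-- The part of the averaged projection that multiplies `sin² b / gap`. -/
noncomputable def limCoeff (θ : ℝ) : Matrix (Fin 3) (Fin 3) ℂ :=
  !![-coinVec θ 0 ^ 2, -(coinVec θ 0 * coinVec θ 1), 1 - coinVec θ 0 ^ 2;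
     -(coinVec θ 0 * coinVec θ 1), 2 * coinVec θ 0 ^ 2, -(coinVec θ 0 * coinVec θ 1);
     1 - coinVec θ 0 ^ 2, -(coinVec θ 0 * coinVec θ 1), -coinVec θ 0 ^ 2]

theorem gap_neg_left (m b a : ℝ) : gap m (-b) a = gap m b a := by simp [gap]

theorem gap_neg_right (m b a : ℝ) : gap m b (-a) = gap m b a := by simp [gap]

/-- The projection onto the span of the axes of the two reflections, times `m * gap`. -/
noncomputable def spanNum (θ b a : ℝ) : Matrix (Fin 3) (Fin 3) ℂ :=
  coinProj θ + shiftedProj θ b a - coinProj θ * shiftedProj θ b a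
    - shiftedProj θ b a * coinProj θ

/-- The sign symmetrization removes the parts odd in either angle. Division by `m * gap` then leaves
a constant matrix and a multiple of `sin² b / gap`, the only function left to integrate. -/
theorem symm4_spanNum (θ b a : ℝ) (j k : Fin 3) :
    symm4 (fun b a => spanNum θ b a j k) b a
      = 4 * (2 * coinVec θ 0 ^ 2) * (gap (Real.sin (θ / 2) ^ 2) b a
          * ((1 : Matrix (Fin 3) (Fin 3) ℂ) j k - limConst j k)
        - limCoeff θ j k * (Real.sin b : ℂ) ^ 2) := by
  rw [gap_eq_exp, sin_sq_eq_exp]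
  simp only [symm4, spanNum, coinProj_mul_shiftedProj, shiftedProj_mul_coinProj, overlap_eq_exp]
  simp only [coinProj, shiftedProj, Matrix.sub_apply, Matrix.add_apply, Matrix.smul_apply,
    Matrix.vecMulVec_apply, smul_eq_mul, Complex.ofReal_neg, exp_neg_mul_I, inv_inv, phase,
    neg_neg]
  have ha := Complex.exp_ne_zero (a * Complex.I)
  have hb := Complex.exp_ne_zero (b * Complex.I)
  have h1 := coinVec_one_sq θ
  generalize Complex.exp (a * Complex.I) = x at *
  generalize Complex.exp (b * Complex.I) = y at *
  fin_cases j <;> fin_cases k <;>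
    simp [limConst, limCoeff, coinVec_two] <;>
    generalize coinVec θ 0 = u at * <;> generalize coinVec θ 1 = w at * <;>
    field_simp <;> (try rw [h1]) <;> ring

end Spectrum

/-! ### The inner integral as time tends to infinity. -/

section Limit

open MeasureTheory

/-- For `k ≠ 0` the phase is strictly monotone on `(0, π)` and its derivative vanishes only at the
endpoints. Cosine and sine are combinations of the exponentials at times `t` and `-t`. -/
theorem tendsto_integral_trig_arccos_mul {p k : ℝ} (hk : k ≠ 0)
    (h : ∀ a, -1 < p + k * Real.cos a ∧ p + k * Real.cos a < 1) {g : ℝ → ℂ} (hg : Continuous g) :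
    Tendsto (fun t : ℕ => ∫ a in (0 : ℝ)..Real.pi,
      (Real.cos (t * Real.arccos (p + k * Real.cos a)) : ℂ) * g a) atTop (𝓝 0) ∧
    Tendsto (fun t : ℕ => ∫ a in (0 : ℝ)..Real.pi,
      (Real.sin (t * Real.arccos (p + k * Real.cos a)) : ℂ) * g a) atTop (𝓝 0) := by
  set φ : ℝ → ℝ := fun a => Real.arccos (p + k * Real.cos a) with hφ
  have hφc : Continuous φ := by fun_prop
  have hder : ∀ a ∈ Set.Ioo 0 Real.pi, HasDerivWithinAt φ
      (-(1 / √(1 - (p + k * Real.cos a) ^ 2)) * (k * -Real.sin a)) (Set.Ioo 0 Real.pi) a := by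
    intro a _
    exact ((Real.hasDerivAt_arccos (h a).1.ne' (h a).2.ne).comp a
      (((Real.hasDerivAt_cos a).const_mul k).const_add p)).hasDerivWithinAt
  have hinj : Set.InjOn φ (Set.Ioo 0 Real.pi) := by
    intro x hx y hy hxy
    have h1 := Real.arccos_injOn ⟨(h x).1.le, (h x).2.le⟩ ⟨(h y).1.le, (h y).2.le⟩ hxy
    exact Real.injOn_cos (Set.Ioo_subset_Icc_self hx) (Set.Ioo_subset_Icc_self hy)
      (mul_left_cancel₀ hk (add_left_cancel h1))
  have hne : ∀ a ∈ Set.Ioo 0 Real.pi,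
      -(1 / √(1 - (p + k * Real.cos a) ^ 2)) * (k * -Real.sin a) ≠ 0 := by
    intro a ha
    have h1 : 0 < 1 - (p + k * Real.cos a) ^ 2 := by nlinarith [(h a).1, (h a).2]
    have h2 := (Real.sqrt_pos.2 h1).ne'
    have h3 := (Real.sin_pos_of_mem_Ioo ha).ne'
    exact mul_ne_zero (neg_ne_zero.2 (one_div_ne_zero h2)) (mul_ne_zero hk (neg_ne_zero.2 h3))
  have key := tendsto_setIntegral_exp_mul g measurableSet_Ioo hder hinj hne
  have key' : Tendsto (fun t : ℝ => ∫ a in (0 : ℝ)..Real.pi,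
      Complex.exp (t * φ a * Complex.I) * g a) (cocompact ℝ) (𝓝 0) := by
    simpa only [intervalIntegral.integral_of_le Real.pi_pos.le, integral_Ioc_eq_integral_Ioo]
      using key
  have hplus : Tendsto (fun t : ℕ => (t : ℝ)) atTop (cocompact ℝ) :=
    tendsto_natCast_atTop_atTop.mono_right atTop_le_cocompact
  have hminus : Tendsto (fun t : ℕ => -(t : ℝ)) atTop (cocompact ℝ) :=
    (tendsto_neg_atTop_atBot.comp tendsto_natCast_atTop_atTop).mono_right atBot_le_cocompact
  have k1 := key'.comp hplus
  have k2 := key'.comp hminus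
  have hint : ∀ t : ℝ, IntervalIntegrable (fun a => Complex.exp (t * φ a * Complex.I) * g a)
      volume 0 Real.pi := fun t => Continuous.intervalIntegrable (by fun_prop) _ _
  constructor
  · have k3 := (k1.add k2).const_mul (1 / 2)
    simp only [add_zero, mul_zero] at k3
    refine k3.congr fun t => ?_
    simp only [Function.comp_apply]
    rw [← intervalIntegral.integral_add (hint _) (hint _), ← intervalIntegral.integral_const_mul]
    refine intervalIntegral.integral_congr fun a _ => ?_
    simp only [Complex.ofReal_cos, Complex.cos, hφ]
    push_cast
    ring_nf
  · have k3 := (k2.sub k1).const_mul (Complex.I / 2)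
    simp only [sub_zero, mul_zero] at k3
    refine k3.congr fun t => ?_
    simp only [Function.comp_apply]
    rw [← intervalIntegral.integral_sub (hint _) (hint _), ← intervalIntegral.integral_const_mul]
    refine intervalIntegral.integral_congr fun a _ => ?_
    simp only [Complex.ofReal_sin, Complex.sin, hφ]
    push_cast
    ring_nf

theorem integral_symm_eq {g : ℝ → ℂ} (hg : Continuous g) :
    ∫ a in -Real.pi..Real.pi, g a = ∫ a in (0 : ℝ)..Real.pi, (g a + g (-a)) := by
  have h1 : ∫ a in (0 : ℝ)..Real.pi, g (-a) = ∫ a in -Real.pi..0, g a := by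
    rw [intervalIntegral.integral_comp_neg, neg_zero]
  have hg' : Continuous fun a => g (-a) := hg.comp continuous_neg
  rw [intervalIntegral.integral_add (hg.intervalIntegrable _ _)
    (hg'.intervalIntegrable _ _), h1, add_comm,
    intervalIntegral.integral_add_adjacent_intervals (hg.intervalIntegrable _ _)
      (hg.intervalIntegrable _ _)]

theorem continuous_symm4 {f : ℝ → ℝ → ℂ} (hf : Continuous f.uncurry) :
    Continuous (symm4 f).uncurry := by
  have h (u : ℝ × ℝ → ℝ × ℝ) (hu : Continuous u) : Continuous fun p => f (u p).1 (u p).2 :=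
    hf.comp hu
  exact ((h (fun p => (p.1, p.2)) (by fun_prop)).add (h (fun p => (p.1, -p.2)) (by fun_prop))).add
    ((h (fun p => (-p.1, p.2)) (by fun_prop)).add (h (fun p => (-p.1, -p.2)) (by fun_prop)))

/-- Folding onto `[0, π]²` makes the phase injective in `a`, as Riemann–Lebesgue requires, and
brings in the symmetrized entries. -/
theorem avg_eq_integral_symm4 {f : ℝ → ℝ → ℂ} (hf : Continuous f.uncurry) :
    avg f = (4 * (Real.pi : ℂ) ^ 2)⁻¹
      * ∫ b in (0 : ℝ)..Real.pi, ∫ a in (0 : ℝ)..Real.pi, symm4 f b a := by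
  have h1 := intervalIntegral.continuous_parametric_intervalIntegral_of_continuous'
    (μ := volume) hf (-Real.pi) Real.pi
  have h2 : ∀ b, Continuous fun a => f b a + f b (-a) := fun b =>
    (hf.uncurry_left b).add ((hf.uncurry_left b).comp continuous_neg)
  rw [avg, integral_symm_eq h1]
  congr 1
  refine intervalIntegral.integral_congr fun b _ => ?_
  simp only [symm4]
  rw [integral_symm_eq (hf.uncurry_left b), integral_symm_eq (hf.uncurry_left (-b)),
    ← intervalIntegral.integral_add ((h2 b).intervalIntegrable _ _)
      ((h2 (-b)).intervalIntegrable _ _)]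

theorem diagonal_phase_mem_unitary (b a : ℝ) :
    Matrix.diagonal (phase b a) ∈ Matrix.unitaryGroup (Fin 3) ℂ := by
  rw [Matrix.mem_unitaryGroup_iff, Matrix.star_eq_conjTranspose, Matrix.diagonal_conjTranspose,
    Matrix.diagonal_mul_diagonal, ← Matrix.diagonal_one]
  congr 1
  ext j
  rw [Pi.star_apply, ← phase_neg, phase_mul_phase_neg]

theorem coinC_mem_unitary (θ : ℝ) : coinC θ ∈ Matrix.unitaryGroup (Fin 3) ℂ := by
  have h1 : star (coinProj θ) = coinProj θ := by
    ext j k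
    simp only [coinProj, Matrix.star_apply, Matrix.vecMulVec_apply, star_mul', star_coinVec]
    ring
  have h2 : star (coinC θ) = coinC θ := by
    rw [coinC_eq, star_sub, star_smul, h1, star_one]
    norm_num
  rw [Matrix.mem_unitaryGroup_iff, h2, coinC_eq, mul_sub, sub_mul, smul_mul_smul_comm,
    coinProj_mul_self, one_mul, mul_one]
  module

theorem norm_evol_pow_le (θ b a : ℝ) (t : ℕ) (j k : Fin 3) : ‖(evol θ b a ^ t) j k‖ ≤ 1 :=
  entry_norm_bound_of_unitary (pow_mem (mul_mem (mul_mem (diagonal_phase_mem_unitary _ _)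
    (coinC_mem_unitary θ)) (mul_mem (diagonal_phase_mem_unitary _ _) (coinC_mem_unitary θ))) t) j k

theorem norm_symm4_le {f : ℝ → ℝ → ℂ} (hf : ∀ b a, ‖f b a‖ ≤ 1) (b a : ℝ) :
    ‖symm4 f b a‖ ≤ 4 := by
  refine (norm_add_le _ _).trans ?_
  linarith [norm_add_le (f b a) (f b (-a)), norm_add_le (f (-b) a) (f (-b) (-a)),
    hf b a, hf b (-a), hf (-b) a, hf (-b) (-a)]

theorem gap_pos {m b : ℝ} (hm : 0 < m) (hm1 : m < 1) (hb : Real.sin b ≠ 0) (a : ℝ) :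
    0 < gap m b a := by
  have h1 : Real.cos a * Real.cos b ≤ 1 := by
    nlinarith [Real.cos_sq_le_one a, Real.cos_sq_le_one b, sq_nonneg (Real.cos a - Real.cos b)]
  have h2 := sq_pos_of_ne_zero hb
  rw [gap]
  nlinarith [mul_nonneg (sub_nonneg.2 hm1.le) (sub_nonneg.2 h1), mul_pos hm h2]

/-- The quantity `1 - m * gap` equals `|m cos b + (1 - m) exp (i a)|²`. It vanishes only for
orthogonal axes, where `φ = π` and the division by `sin φ` fails. -/
theorem mul_gap_lt_one {m b : ℝ} (hm1 : m < 1) (h1 : m * Real.cos b ≠ 1 - m)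
    (h2 : m * Real.cos b ≠ -(1 - m)) (a : ℝ) : m * gap m b a < 1 := by
  have hq : 1 - m ≠ 0 := (sub_pos.2 hm1).ne'
  have hs := Real.sin_sq_add_cos_sq a
  have hsb := Real.sin_sq_add_cos_sq b
  have heq : 1 - m * gap m b a
      = (m * Real.cos b + (1 - m) * Real.cos a) ^ 2 + ((1 - m) * Real.sin a) ^ 2 := by
    rw [gap]
    linear_combination -(1 - m) ^ 2 * hs - m ^ 2 * hsb
  by_contra hle
  have h0 : (m * Real.cos b + (1 - m) * Real.cos a) ^ 2 + ((1 - m) * Real.sin a) ^ 2 ≤ 0 := by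
    linarith
  have h3 : m * Real.cos b + (1 - m) * Real.cos a = 0 := by
    nlinarith [sq_nonneg (m * Real.cos b + (1 - m) * Real.cos a), sq_nonneg ((1 - m) * Real.sin a)]
  have h4 : (1 - m) * Real.sin a = 0 := by
    nlinarith [sq_nonneg (m * Real.cos b + (1 - m) * Real.cos a), sq_nonneg ((1 - m) * Real.sin a)]
  rcases Real.sin_eq_zero_iff_cos_eq.1 ((mul_eq_zero.1 h4).resolve_left hq) with h | h
  · exact h2 (by rw [h] at h3; linarith)
  · exact h1 (by rw [h] at h3; linarith)

/-- Twice the commutator of the two projections. -/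
noncomputable def twiceComm (θ b a : ℝ) : Matrix (Fin 3) (Fin 3) ℂ :=
  (2 : ℂ) • (shiftedProj θ b a * coinProj θ - coinProj θ * shiftedProj θ b a)

theorem evol_pow_eq {θ b a φ : ℝ} (hgap : Real.sin (θ / 2) ^ 2 * gap (Real.sin (θ / 2) ^ 2) b a ≠ 0)
    (hcos : Real.cos φ = 1 - 2 * (Real.sin (θ / 2) ^ 2 * gap (Real.sin (θ / 2) ^ 2) b a))
    (hsin : Real.sin φ ≠ 0) (t : ℕ) :
    evol θ b a ^ t = 1
      + ((Real.cos (t * φ) - 1 : ℂ) * (Real.sin (θ / 2) ^ 2 * gap (Real.sin (θ / 2) ^ 2) b a : ℝ)⁻¹)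
        • spanNum θ b a + ((Real.sin (t * φ) : ℂ) / Real.sin φ) • twiceComm θ b a := by
  have hτ : 1 - ((1 - Real.sin (θ / 2) ^ 2 * gap (Real.sin (θ / 2) ^ 2) b a : ℝ) : ℂ)
      = (Real.sin (θ / 2) ^ 2 * gap (Real.sin (θ / 2) ^ 2) b a : ℝ) := by push_cast; ring
  rw [evol_eq, reflections_pow (coinProj_mul_self θ) (shiftedProj_mul_self θ b a)
    (coinProj_mul_shiftedProj_mul θ b a) (shiftedProj_mul_coinProj_mul θ b a)
    (by rw [hτ]; exact_mod_cast hgap) (φ := φ) (by rw [hcos]; push_cast; ring)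
    (by exact_mod_cast hsin), spanProj, hτ, spanNum, twiceComm]
  push_cast
  module

theorem continuous_shiftedProj (θ : ℝ) : Continuous fun p : ℝ × ℝ => shiftedProj θ p.1 p.2 := by
  refine continuous_matrix fun j k => ?_
  simp only [shiftedProj, Matrix.vecMulVec_apply]
  exact (((continuous_phase j).comp (continuous_fst.neg.prodMk continuous_snd.neg)).mul
    continuous_const).mul ((continuous_phase k).mul continuous_const)

/-- The gap is even in both angles, so one `φ` serves all four sign choices and symmetrization acts
on the matrices alone. The commutator is left unevaluated: its term oscillates away. -/
theorem symm4_evol_pow {θ b a φ : ℝ} (hm : Real.sin (θ / 2) ≠ 0)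
    (hgap : gap (Real.sin (θ / 2) ^ 2) b a ≠ 0)
    (hcos : Real.cos φ = 1 - 2 * (Real.sin (θ / 2) ^ 2 * gap (Real.sin (θ / 2) ^ 2) b a))
    (hsin : Real.sin φ ≠ 0) (t : ℕ) (j k : Fin 3) :
    symm4 (fun b a => (evol θ b a ^ t) j k) b a
      = 4 * (limConst j k
          + limCoeff θ j k * ((Real.sin b : ℂ) ^ 2 * (gap (Real.sin (θ / 2) ^ 2) b a : ℂ)⁻¹))
        + (Real.cos (t * φ) : ℂ) * (4 * ((1 : Matrix (Fin 3) (Fin 3) ℂ) j k - limConst j k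
          - limCoeff θ j k * ((Real.sin b : ℂ) ^ 2 * (gap (Real.sin (θ / 2) ^ 2) b a : ℂ)⁻¹)))
        + (Real.sin (t * φ) : ℂ) * ((Real.sin φ : ℂ)⁻¹ * symm4 (fun b a => twiceComm θ b a j k) b a) := by
  have hu : 2 * coinVec θ 0 ^ 2 = (Real.sin (θ / 2) : ℂ) ^ 2 := by
    rw [coinVec_zero_sq]; push_cast; ring
  have hm' : (Real.sin (θ / 2) : ℂ) ≠ 0 := by exact_mod_cast hm
  have hg' : (gap (Real.sin (θ / 2) ^ 2) b a : ℂ) ≠ 0 := by exact_mod_cast hgap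
  have hprod := mul_ne_zero (pow_ne_zero 2 hm) hgap
  have hN := symm4_spanNum θ b a j k
  rw [hu] at hN
  have e (b' a' : ℝ) (h : gap (Real.sin (θ / 2) ^ 2) b' a' = gap (Real.sin (θ / 2) ^ 2) b a) :=
    evol_pow_eq (by rw [h]; exact hprod) (by rw [h]; exact hcos) hsin t (b := b') (a := a')
  simp only [symm4] at hN ⊢
  rw [e b a rfl, e b (-a) (gap_neg_right _ _ _), e (-b) a (gap_neg_left _ _ _),
    e (-b) (-a) (by rw [gap_neg_right, gap_neg_left])]
  simp only [gap_neg_left, gap_neg_right]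
  simp only [Matrix.add_apply, Matrix.smul_apply, smul_eq_mul]
  push_cast at hN ⊢
  linear_combination (norm := skip) ((Complex.cos (t * φ) - 1)
    * ((Complex.sin (θ / 2)) ^ 2 * (gap (Real.sin (θ / 2) ^ 2) b a : ℂ))⁻¹) * hN
  push_cast at hm'
  field_simp
  ring

theorem continuous_twiceComm (θ : ℝ) : Continuous fun p : ℝ × ℝ => twiceComm θ p.1 p.2 :=
  ((((continuous_shiftedProj θ).mul continuous_const).sub
    (continuous_const.mul (continuous_shiftedProj θ))).const_smul (2 : ℂ))

theorem integral_sin_sq_mul_inv_gap {m b : ℝ} (hm : 0 < m) (hm1 : m < 1) (hb : 0 < Real.sin b) :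
    ∫ a in (0 : ℝ)..Real.pi, Real.sin b ^ 2 * (gap m b a)⁻¹
      = Real.pi * (Real.sin b / √((2 - m) ^ 2 - m ^ 2 * Real.cos b ^ 2)) := by
  have hpos := sq_mul_cos_lt hm (show m < 2 - m by linarith) b
  have hsq := Real.sqrt_pos.2 hpos
  have h1 : ∀ a, gap m b a = (2 * (1 - m) + m * Real.sin b ^ 2)
      - (2 * (1 - m) * Real.cos b) * Real.cos a := fun a => by rw [gap]; ring
  -- With `p` this number and `q = 2 (1 - m) cos b`, the root `r` of `p² - q²` is `sin b √((2 - m)²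
  -- - m² cos² b)`.
  have hp : 0 < 2 * (1 - m) + m * Real.sin b ^ 2 := by
    have := mul_pos hm (pow_pos hb 2); linarith
  simp only [h1]
  rw [intervalIntegral.integral_const_mul, integral_inv_sub_mul_cos (mul_pos hb hsq) hp]
  · field_simp
  · rw [mul_pow, Real.sq_sqrt hpos.le]
    have := Real.sin_sq_add_cos_sq b
    have h2 : Real.cos b ^ 2 = 1 - Real.sin b ^ 2 := by linarith
    rw [mul_pow _ (Real.cos b), h2]
    ring

/-- The limit of the inner integral of the evolution. -/
theorem tendsto_integral_symm4_evol_pow {θ b : ℝ} (hm : 0 < Real.sin (θ / 2) ^ 2)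
    (hm1 : Real.sin (θ / 2) ^ 2 < 1) (hb : b ∈ Set.Ioo 0 Real.pi) (hb0 : Real.cos b ≠ 0)
    (h1 : Real.sin (θ / 2) ^ 2 * Real.cos b ≠ 1 - Real.sin (θ / 2) ^ 2)
    (h2 : Real.sin (θ / 2) ^ 2 * Real.cos b ≠ -(1 - Real.sin (θ / 2) ^ 2)) (j k : Fin 3) :
    Tendsto (fun t : ℕ => ∫ a in (0 : ℝ)..Real.pi,
        symm4 (fun b a => (evol θ b a ^ t) j k) b a) atTop
      (𝓝 (4 * Real.pi * (limConst j k + limCoeff θ j k * ((Real.sin b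
        / √((2 - Real.sin (θ / 2) ^ 2) ^ 2 - (Real.sin (θ / 2) ^ 2) ^ 2 * Real.cos b ^ 2) : ℝ)
          : ℂ)))) := by
  have hs0 : Real.sin (θ / 2) ≠ 0 := fun h => by simp [h] at hm
  set m := Real.sin (θ / 2) ^ 2 with hmdef
  have hsb := Real.sin_pos_of_mem_Ioo hb
  have hgap := gap_pos hm hm1 hsb.ne'
  have hlt := mul_gap_lt_one hm1 h1 h2
  have hcos_eq : ∀ a, 1 - 2 * (m * gap m b a) = (1 - 4 * m * (1 - m) - 2 * m ^ 2 * Real.sin b ^ 2)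
      + (4 * m * (1 - m) * Real.cos b) * Real.cos a := fun a => by rw [gap]; ring
  have hrange : ∀ a, -1 < 1 - 2 * (m * gap m b a) ∧ 1 - 2 * (m * gap m b a) < 1 := fun a =>
    ⟨by linarith [hlt a], by linarith [mul_pos hm (hgap a)]⟩
  -- If `cos b = 0` the phase does not depend on `a` and there is no decay.
  have hk : 4 * m * (1 - m) * Real.cos b ≠ 0 :=
    mul_ne_zero (mul_pos (by linarith) (sub_pos.2 hm1)).ne' hb0
  let φ : ℝ → ℝ := fun a => Real.arccos (1 - 2 * (m * gap m b a))
  have hgapc : Continuous fun a => gap m b a := by unfold gap; fun_prop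
  have hφc : Continuous φ := by fun_prop
  have hcosφ : ∀ a, Real.cos (φ a) = 1 - 2 * (m * gap m b a) := fun a =>
    Real.cos_arccos (hrange a).1.le (hrange a).2.le
  have hsinφ : ∀ a, Real.sin (φ a) ≠ 0 := fun a => by
    rw [Real.sin_arccos]
    exact (Real.sqrt_pos.2 (by nlinarith [(hrange a).1, (hrange a).2])).ne'
  have hinv : Continuous fun a => (gap m b a : ℂ)⁻¹ :=
    (Complex.continuous_ofReal.comp hgapc).inv₀
      fun a => Complex.ofReal_ne_zero.2 (hgap a).ne'
  have hsinv : Continuous fun a => (Real.sin (φ a) : ℂ)⁻¹ :=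
    (Complex.continuous_ofReal.comp (Real.continuous_sin.comp hφc)).inv₀
      fun a => Complex.ofReal_ne_zero.2 (hsinφ a)
  have hcomm : Continuous fun a => symm4 (fun b a => twiceComm θ b a j k) b a :=
    (continuous_symm4 (f := fun b a => twiceComm θ b a j k)
      ((continuous_twiceComm θ).matrix_elem j k)).uncurry_left b
  let g₀ : ℝ → ℂ := fun a =>
    4 * (limConst j k + limCoeff θ j k * ((Real.sin b : ℂ) ^ 2 * (gap m b a : ℂ)⁻¹))
  let g₁ : ℝ → ℂ := fun a => 4 * ((1 : Matrix (Fin 3) (Fin 3) ℂ) j k - limConst j k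
    - limCoeff θ j k * ((Real.sin b : ℂ) ^ 2 * (gap m b a : ℂ)⁻¹))
  let g₂ : ℝ → ℂ := fun a =>
    (Real.sin (φ a) : ℂ)⁻¹ * symm4 (fun b a => twiceComm θ b a j k) b a
  have hg₀ : Continuous g₀ := by fun_prop
  have hg₁ : Continuous g₁ := by fun_prop
  have hg₂ : Continuous g₂ := by fun_prop
  have hdec : ∀ (t : ℕ) a, symm4 (fun b a => (evol θ b a ^ t) j k) b a
      = g₀ a + (Real.cos (t * φ a) : ℂ) * g₁ a + (Real.sin (t * φ a) : ℂ) * g₂ a := fun t a =>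
    symm4_evol_pow hs0 (hgap a).ne' (hcosφ a) (hsinφ a) t j k
  have hrange' : ∀ a, -1 < (1 - 4 * m * (1 - m) - 2 * m ^ 2 * Real.sin b ^ 2)
      + (4 * m * (1 - m) * Real.cos b) * Real.cos a ∧
      (1 - 4 * m * (1 - m) - 2 * m ^ 2 * Real.sin b ^ 2)
      + (4 * m * (1 - m) * Real.cos b) * Real.cos a < 1 := fun a => hcos_eq a ▸ hrange a
  have l1 := (tendsto_integral_trig_arccos_mul hk hrange' hg₁).1
  have l2 := (tendsto_integral_trig_arccos_mul hk hrange' hg₂).2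
  simp only [← hcos_eq] at l1 l2
  have hint : ∫ a in (0 : ℝ)..Real.pi, g₀ a = 4 * Real.pi * (limConst j k + limCoeff θ j k
      * ((Real.sin b / √((2 - m) ^ 2 - m ^ 2 * Real.cos b ^ 2) : ℝ) : ℂ)) := by
    have hi : ∫ a in (0 : ℝ)..Real.pi, ((Real.sin b : ℂ) ^ 2 * (gap m b a : ℂ)⁻¹)
        = (Real.pi * (Real.sin b / √((2 - m) ^ 2 - m ^ 2 * Real.cos b ^ 2)) : ℝ) := by
      rw [← integral_sin_sq_mul_inv_gap hm hm1 hsb, ← intervalIntegral.integral_ofReal]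
      push_cast
      rfl
    simp only [g₀]
    rw [intervalIntegral.integral_const_mul, intervalIntegral.integral_add
      (continuous_const.intervalIntegrable _ _)
      (Continuous.intervalIntegrable (by fun_prop) _ _), intervalIntegral.integral_const_mul, hi,
      intervalIntegral.integral_const]
    simp only [sub_zero, Complex.real_smul, Complex.ofReal_mul]
    ring
  rw [← hint]
  have l3 := (tendsto_const_nhds (x := ∫ a in (0 : ℝ)..Real.pi, g₀ a)).add (l1.add l2)
  rw [add_zero, add_zero] at l3
  refine l3.congr fun t => ?_
  simp only [hdec]
  have c1 : Continuous fun a => (Real.cos (t * φ a) : ℂ) * g₁ a := by fun_prop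
  have c2 : Continuous fun a => (Real.sin (t * φ a) : ℂ) * g₂ a := by fun_prop
  have c12 : Continuous fun a =>
      (Real.cos (t * φ a) : ℂ) * g₁ a + (Real.sin (t * φ a) : ℂ) * g₂ a := c1.add c2
  rw [← intervalIntegral.integral_add (c1.intervalIntegrable _ _) (c2.intervalIntegrable _ _),
    ← intervalIntegral.integral_add (hg₀.intervalIntegrable _ _)
      (c12.intervalIntegrable _ _)]
  simp only [add_assoc]

end Limit

/-! ### The outer integral and the closed form. -/

section Main

open MeasureTheory

theorem ae_cos_ne (κ : ℝ) : ∀ᵐ b : ℝ, b ∈ Set.Ioo 0 Real.pi → Real.cos b ≠ κ := by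
  have h : Set.Subsingleton {b : ℝ | ¬(b ∈ Set.Ioo 0 Real.pi → Real.cos b ≠ κ)} := by
    intro x hx y hy
    simp only [Set.mem_ofPred_eq, Classical.not_imp, not_not] at hx hy
    exact Real.injOn_cos (Set.Ioo_subset_Icc_self hx.1) (Set.Ioo_subset_Icc_self hy.1)
      (hx.2.trans hy.2.symm)
  exact h.finite.measure_zero volume

theorem tendsto_avg_evol_pow {θ : ℝ} (hm : 0 < Real.sin (θ / 2) ^ 2)
    (hm1 : Real.sin (θ / 2) ^ 2 < 1) (j k : Fin 3) :
    Tendsto (fun t : ℕ => avg fun b a => (evol θ b a ^ t) j k) atTop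
      (𝓝 (limConst j k + limCoeff θ j k * ((2 / (Real.pi * Real.sin (θ / 2) ^ 2)
        * Real.arcsin (Real.sin (θ / 2) ^ 2 / (2 - Real.sin (θ / 2) ^ 2)) : ℝ) : ℂ))) := by
  have hf : ∀ t : ℕ, Continuous (Function.uncurry fun b a => (evol θ b a ^ t) j k) := fun t =>
    (continuous_evol_pow θ t).matrix_elem j k
  have hpi : (Real.pi : ℂ) ≠ 0 := by exact_mod_cast Real.pi_ne_zero
  have key : Tendsto (fun t : ℕ => ∫ b in (0 : ℝ)..Real.pi, ∫ a in (0 : ℝ)..Real.pi,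
      symm4 (fun b a => (evol θ b a ^ t) j k) b a) atTop
      (𝓝 (∫ b in (0 : ℝ)..Real.pi, 4 * Real.pi * (limConst j k + limCoeff θ j k * ((Real.sin b
        / √((2 - Real.sin (θ / 2) ^ 2) ^ 2 - (Real.sin (θ / 2) ^ 2) ^ 2 * Real.cos b ^ 2) : ℝ)
          : ℂ)))) := by
    -- Unitarity bounds each entry by `1`, hence the symmetrized entry by `4`, uniformly in time.
    refine intervalIntegral.tendsto_integral_filter_of_dominated_convergence
      (fun _ => 4 * |Real.pi - 0|) (Eventually.of_forall fun t => ?_)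
      (Eventually.of_forall fun t => Eventually.of_forall fun b _ => ?_)
      intervalIntegrable_const ?_
    · exact (intervalIntegral.continuous_parametric_intervalIntegral_of_continuous'
        (continuous_symm4 (hf t)) 0 Real.pi).aestronglyMeasurable
    · exact intervalIntegral.norm_integral_le_of_norm_le_const fun a _ =>
        norm_symm4_le (fun b a => norm_evol_pow_le θ b a t j k) b a
    -- Discarded are the `b` with constant phase, those where the axes can become orthogonal, and
    -- the endpoint `π`, where `sin b = 0`.
    · filter_upwards [ae_cos_ne 0,
        ae_cos_ne ((1 - Real.sin (θ / 2) ^ 2) / Real.sin (θ / 2) ^ 2),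
        ae_cos_ne (-(1 - Real.sin (θ / 2) ^ 2) / Real.sin (θ / 2) ^ 2),
        Measure.ae_ne volume Real.pi] with b h0 h1 h2 hπ hb
      rw [Set.uIoc_of_le Real.pi_pos.le] at hb
      have hb' : b ∈ Set.Ioo 0 Real.pi := ⟨hb.1, lt_of_le_of_ne hb.2 hπ⟩
      exact tendsto_integral_symm4_evol_pow hm hm1 hb' (h0 hb')
        (fun h => h1 hb' (by rw [← h, mul_div_cancel_left₀ _ hm.ne']))
        (fun h => h2 hb' (by rw [← h, mul_div_cancel_left₀ _ hm.ne'])) j k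
  have hsum : ∫ b in (0 : ℝ)..Real.pi, 4 * Real.pi * (limConst j k + limCoeff θ j k * ((Real.sin b
        / √((2 - Real.sin (θ / 2) ^ 2) ^ 2 - (Real.sin (θ / 2) ^ 2) ^ 2 * Real.cos b ^ 2) : ℝ)
          : ℂ)) = 4 * Real.pi * (Real.pi * limConst j k + limCoeff θ j k
            * ((2 / Real.sin (θ / 2) ^ 2
        * Real.arcsin (Real.sin (θ / 2) ^ 2 / (2 - Real.sin (θ / 2) ^ 2)) : ℝ) : ℂ)) := by
    have hlt : Real.sin (θ / 2) ^ 2 < 2 - Real.sin (θ / 2) ^ 2 := by linarith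
    have hc : Continuous fun b => Real.sin b
        / √((2 - Real.sin (θ / 2) ^ 2) ^ 2 - (Real.sin (θ / 2) ^ 2) ^ 2 * Real.cos b ^ 2) :=
      Continuous.div (by fun_prop) (by fun_prop) fun b =>
        (Real.sqrt_pos.2 (sq_mul_cos_lt hm hlt b)).ne'
    have hc' : Continuous fun b => limCoeff θ j k * ((Real.sin b
        / √((2 - Real.sin (θ / 2) ^ 2) ^ 2 - (Real.sin (θ / 2) ^ 2) ^ 2 * Real.cos b ^ 2) : ℝ)
          : ℂ) := continuous_const.mul (Complex.continuous_ofReal.comp hc)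
    rw [← integral_sin_div_sqrt hm hlt, intervalIntegral.integral_const_mul,
      intervalIntegral.integral_add (continuous_const.intervalIntegrable _ _)
        (hc'.intervalIntegrable _ _),
      intervalIntegral.integral_const_mul, intervalIntegral.integral_ofReal,
      intervalIntegral.integral_const, sub_zero, Complex.real_smul]
  rw [hsum] at key
  simp only [avg_eq_integral_symm4 (hf _)]
  convert key.const_mul ((4 * (Real.pi : ℂ) ^ 2)⁻¹) using 2
  have hm' : (Real.sin (θ / 2) : ℂ) ≠ 0 := by
    have h : Real.sin (θ / 2) ≠ 0 := fun h => by simp [h] at hm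
    exact_mod_cast h
  push_cast at hm' ⊢
  field_simp

theorem A_eq (θ : ℝ) :
    A θ = Real.arcsin (Real.sin (θ / 2) ^ 2 / (2 - Real.sin (θ / 2) ^ 2)) := by
  have h : Real.cos θ = 1 - 2 * Real.sin (θ / 2) ^ 2 := by
    rw [← mul_div_cancel₀ θ (two_ne_zero' ℝ), Real.cos_two_mul,
      mul_div_cancel₀ θ (two_ne_zero' ℝ), Real.cos_sq']
    ring
  rw [A, h, show 1 - (1 - 2 * Real.sin (θ / 2) ^ 2) = 2 * Real.sin (θ / 2) ^ 2 by ring,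
    show 3 + (1 - 2 * Real.sin (θ / 2) ^ 2) = 2 * (2 - Real.sin (θ / 2) ^ 2) by ring,
    mul_div_mul_left _ _ (two_ne_zero' ℝ)]

theorem coinVec_zero_mul_one (θ : ℝ) :
    coinVec θ 0 * coinVec θ 1 = ((√2 * Real.sin θ / 4 : ℝ) : ℂ) := by
  have h2 : √2 * √2 = 2 := Real.mul_self_sqrt (by norm_num)
  have h : Real.sin (θ / 2) / √2 * Real.cos (θ / 2) = √2 * Real.sin θ / 4 := by
    nth_rw 3 [← mul_div_cancel₀ θ (two_ne_zero' ℝ)]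
    rw [Real.sin_two_mul]
    field_simp
    linear_combination (-2 * Real.sin (θ / 2) * Real.cos (θ / 2)) * h2
  rw [← h]
  simp [coinVec]

end Main

end HexWalk

theorem theorem1 (θ : ℝ) (hθ : θ ∈ Set.Ico 0 (2 * Real.pi)) (hθ0 : θ ≠ 0) (hθπ : θ ≠ Real.pi)
    (α β γ : ℂ) (hnorm : ‖α‖ ^ 2 + ‖β‖ ^ 2 + ‖γ‖ ^ 2 = 1)
    (c s A : ℝ) (hc : c = Real.cos θ) (hs : s = Real.sin θ) (hA : A = HexWalk.A θ) :
    Tendsto (fun t : ℕ => HexWalk.prob θ α β γ (2 * t) (0, 0)) atTop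
      (𝓝 (‖((1 / 2 - A / Real.pi : ℝ) : ℂ) * α
              - ((√2 * s * A / (Real.pi * (1 - c)) : ℝ) : ℂ) * β
              + (((3 + c) * A / (Real.pi * (1 - c)) - 1 / 2 : ℝ) : ℂ) * γ‖ ^ 2
          + ‖((√2 * A / (Real.pi * (1 - c)) : ℝ) : ℂ)
              * ((s : ℂ) * α - ((√2 * (1 - c) : ℝ) : ℂ) * β + (s : ℂ) * γ)‖ ^ 2
          + ‖(((3 + c) * A / (Real.pi * (1 - c)) - 1 / 2 : ℝ) : ℂ) * α
              - ((√2 * s * A / (Real.pi * (1 - c)) : ℝ) : ℂ) * β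
              + ((1 / 2 - A / Real.pi : ℝ) : ℂ) * γ‖ ^ 2)) ∧
    ∀ t : ℕ, HexWalk.prob θ α β γ (2 * t + 1) (0, 0) = 0 := by
  refine ⟨?_, fun t => ?_⟩
  swap
  · rw [HexWalk.prob_origin]
    exact Finset.sum_eq_zero fun j _ => by
      rw [HexWalk.origin, HexWalk.walk_odd_one, norm_zero, zero_pow two_ne_zero]
  have hsin : 0 < Real.sin (θ / 2) := by
    refine Real.sin_pos_of_pos_of_lt_pi ?_ ?_
    · linarith [lt_of_le_of_ne hθ.1 hθ0.symm]
    · linarith [hθ.2]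
  have hcos : Real.cos (θ / 2) ≠ 0 := by
    intro h
    rw [← Real.cos_pi_div_two] at h
    have := Real.injOn_cos ⟨by linarith [hθ.1], by linarith [hθ.2]⟩
      ⟨by linarith [Real.pi_pos], by linarith [Real.pi_pos]⟩ h
    exact hθπ (by linarith)
  -- The excluded angles `0` and `π` are the degenerate cases `m = 0` and `m = 1`.
  have hm : 0 < Real.sin (θ / 2) ^ 2 := pow_pos hsin 2
  have hm1 : Real.sin (θ / 2) ^ 2 < 1 := by
    have := Real.sin_sq_add_cos_sq (θ / 2)
    linarith [sq_pos_of_ne_zero hcos]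
  have hmc : Real.sin (θ / 2) ^ 2 = (1 - c) / 2 := by
    rw [hc, ← mul_div_cancel₀ θ (two_ne_zero' ℝ), Real.cos_two_mul,
      mul_div_cancel₀ θ (two_ne_zero' ℝ), Real.cos_sq']
    ring
  have hc0 : (1 : ℂ) - c ≠ 0 := by
    have h : (1 - c : ℝ) ≠ 0 := by linarith
    exact_mod_cast h
  have hpi : (Real.pi : ℂ) ≠ 0 := by exact_mod_cast Real.pi_ne_zero
  have hu := HexWalk.coinVec_zero_sq θ
  have hw := HexWalk.coinVec_zero_mul_one θ
  have h2 : ((√2 : ℝ) : ℂ) ^ 2 = 2 := by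
    rw [← Complex.ofReal_pow, Real.sq_sqrt (by norm_num)]; norm_num
  have hlim := HexWalk.tendsto_avg_evol_pow hm hm1
  rw [← HexWalk.A_eq, ← hA] at hlim
  rw [hmc] at hu hlim
  rw [← hs] at hw
  simp only [HexWalk.prob_origin, HexWalk.walk_even_origin]
  have hconv := tendsto_finsetSum Finset.univ fun (j : Fin 3) _ =>
    ((tendsto_finsetSum Finset.univ fun (k : Fin 3) _ =>
      (hlim j k).const_mul (![α, β, γ] k)).norm.pow 2)
  convert hconv using 2
  simp only [Fin.sum_univ_three, HexWalk.limConst, HexWalk.limCoeff, Matrix.of_apply,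
    Matrix.cons_val', Matrix.cons_val_zero, Matrix.cons_val_one, Matrix.cons_val,
    hu, hw]
  congr 1
  · congr 1
    · congr 2
      push_cast
      field_simp
      ring
    -- The middle component of the limit is the negative of the stated expression.
    · rw [← norm_neg]
      congr 2
      push_cast
      field_simp
      linear_combination (4 * A * β * (1 - c)) * h2
  · congr 2
    push_cast
    field_simp
    ring
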